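/- **Conventions.** A small category without loops (scwol) $X$ consists of a vertex set $VX$, an edge set $EX$, maps $i,t:EX\to VX$ and an associative composition $(a,b)\mapsto ab$ for edges with $i(a)=t(b)$, such that $i(ab)=i(b)$, $t(ab)=t(a)$ and $i(a)\ne t(a)$ for all edges. A morphism of scwols $f:X\to Y$ consists of maps on vertices and edges that commute with $i$, $t$ and composition and that map the edges with initial vertex $\sigma$ bijectively onto the edges with initial vertex $f(\sigma)$, for every $\sigma\in VX$. A complex of groups $\mathbb X$ over $X$ consists of groups $G_\sigma$ ($\sigma\in VX$), monomorphisms $\psi_a:G_{i(a)}\to G_{t(a)}$ ($a\in EX$) and elements $g_{a,b}\in G_{t(a)}$ (for $i(a)=t(b)$) with $g_{a,b}\,\psi_{ab}(x)\,g_{a,b}^{-1}=\psi_a(\psi_b(x))$ and $\psi_a(g_{b,c})g_{a,bc}=g_{a,b}g_{ab,c}$. All underlying scwols are assumed to be connected. A morphism $\phi:\mathbb X\to\mathbb Y$ over a morphism of scwols $f:X\to Y$ consists of homomorphisms $\phi_\sigma:G_\sigma\to G_{f(\sigma)}$ and elements $\phi(a)\in G_{f(t(a))}$ with $\phi(a)\,\psi_{f(a)}(\phi_{i(a)}(x))\,\phi(a)^{-1}=\phi_{t(a)}(\psi_a(x))$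 and $\phi_{t(a)}(g_{a,b})\phi(ab)=\phi(a)\psi_{f(a)}(\phi(b))g_{f(a),f(b)}$. It is an isomorphism if $f$ and all $\phi_\sigma$ are bijective. The composition $\eta\circ\phi$ has local homomorphisms $\eta_{f(\sigma)}\circ\phi_\sigma$ and edge elements $\eta_{f(t(a))}(\phi(a))\,\eta(f(a))$. A morphism $(\mathbb X,\sigma_0)\to(\mathbb Y,\tau_0)$ is a morphism with $f(\sigma_0)=\tau_0$. An action of a group $G$ on a scwol $W$ is an action by automorphisms such that $g\cdot i(a)\ne t(a)$ for all $g$, $a$, and $g\cdot i(a)=i(a)$ implies $g\cdot a=a$. The complex of groups over $W/G$ associated to it is given by choosing lifts $\bar\sigma\in VW$ of the vertices $\sigma$, the lift $\bar a$ of each edge $a$ with $i(\bar a)=\overline{i(a)}$, and elements $h_a\in G$ with $h_a\cdot t(\bar a)=\overline{t(a)}$: the local groups are the isotropy groups of the $\bar\sigma$, $\psi_a$ is conjugation by $h_a$, and $g_{a,b}=h_ah_bh_{ab}^{-1}$. A complex of groups is developable if it is isomorphic to one obtained in this way. A covering is a morphism $\phi:\mathbb X\to\mathbb Y$ over a morphism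 $f$ that is surjective (on vertices and edges) such that every $\phi_\sigma$ is injective and, for all $\sigma\in VX$ and all $a'\in EY$ with $t(a')=f(\sigma)$, the map $$\coprod_{a\in f^{-1}(a'),\,t(a)=\sigma}G_\sigma/\psi_a(G_{i(a)})\to G_{f(\sigma)}/\psi_{a'}(G_{i(a')}),\qquad g\,\psi_a(G_{i(a)})\mapsto\phi_\sigma(g)\phi(a)\,\psi_{a'}(G_{i(a')})$$ is bijective. The fundamental group $\pi_1(\mathbb X,\sigma_0)$ consists of the classes of $\mathbb X$-loops $(g_0,e_1,g_1,\dots,e_n,g_n)$ at $\sigma_0$ ($n\ge 0$, $e_j$ an edge or a formal inverse edge, with $t(e_j)=i(e_{j+1})$, $g_0\in G_{\sigma_0}$, $g_j\in G_{t(e_j)}$) under the equivalence relation generated by the following replacements of subpaths: $(kg,a,h)\to(k,a,\psi_a(g)h)$; $(g,a^{-1},hk)\to(g\psi_a(h),a^{-1},k)$; $(g,a,\psi_a(h),a^{-1},k)\to(ghk)$; $(g,b^{-1},h,b,k)\to(g\psi_b(h)k)$; $(g,b,1,a,k)\to(g,ab,g_{a,b}^{-1}k)$; $(g,a^{-1},1,b^{-1},k)\to(gg_{a,b},(ab)^{-1},k)$.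 The product is induced by concatenation $(\dots,e_k,g_k)\star(g_0',e_1',\dots)=(\dots,e_k,g_kg_0',e_1',\dots)$. A morphism $\phi:(\mathbb X,\sigma_0)\to(\mathbb Y,\tau_0)$ induces a homomorphism $\phi_*:\pi_1(\mathbb X,\sigma_0)\to\pi_1(\mathbb Y,\tau_0)$ by $(g)\mapsto(\phi_\sigma(g))$, $(1,a,1)\mapsto(1,f(a),\phi(a)^{-1})$, $(1,a^{-1},1)\mapsto(\phi(a),f(a)^{-1},1)$ and multiplicativity. If $\phi$ is a covering, $\phi_*(\pi_1(\mathbb X,\sigma_0))$ is called its characteristic subgroup. Two morphisms $\phi,\eta:\mathbb X\to\mathbb Y$ over the same morphism of scwols $f$ are homotopic relative to $\sigma_0\in VX$, written $\phi\sim_{\sigma_0}\eta$, if there are $k_\sigma\in G_{f(\sigma)}$ ($\sigma\in VX$) with $k_{\sigma_0}=1$, $\eta_\sigma(x)=k_\sigma\phi_\sigma(x)k_\sigma^{-1}$ and $\eta(a)=k_{t(a)}\phi(a)\psi_{f(a)}(k_{i(a)}^{-1})$. **Lemma.** Let $\phi^i:(\mathbb X^i,\sigma_i)\to(\mathbb Y,\tau)$,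 $i=1,2$, be coverings of developable complexes of groups with the same characteristic subgroup: $$\phi^1_*(\pi_1(\mathbb X^1,\sigma_1))=\phi^2_*(\pi_1(\mathbb X^2,\sigma_2))\le\pi_1(\mathbb Y,\tau).$$ Then there exists an isomorphism $\eta:(\mathbb X^1,\sigma_1)\to(\mathbb X^2,\sigma_2)$ (in particular $\eta$ maps $\sigma_1$ to $\sigma_2$) such that $\phi^2\circ\eta\sim_{\sigma_1}\phi^1$. -/

import Mathlib

universe u

/-! ### Small categories without loops -/

/-- A small category without loops (scwol). The edges are indexed by their end points: `X.E σ τ` is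
the set of edges `a` with initial vertex `i(a) = σ` and terminal vertex `t(a) = τ`, so that
`X.comp a b` is the product `ab`, defined if `i(a) = t(b)`. -/
structure Scwol where
  V : Type u
  E : V → V → Type u
  comp : ∀ {ρ σ τ : V}, E σ τ → E ρ σ → E ρ τ
  assoc : ∀ {ρ σ τ υ : V} (a : E τ υ) (b : E σ τ) (c : E ρ σ),
    comp (comp a b) c = comp a (comp b c)
  no_loops : ∀ {σ τ : V}, E σ τ → σ ≠ τ

namespace Scwol

/-- All edges of `X`, each with its initial and its terminal vertex. -/
abbrev Edge (X : Scwol.{u}) : Type u := Σ σ τ : X.V, X.E σ τ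

/-- The edges with initial vertex `σ`. -/
abbrev OutEdge (X : Scwol.{u}) (σ : X.V) : Type u := Σ τ : X.V, X.E σ τ

/-- The edges with terminal vertex `τ`. -/
abbrev InEdge (X : Scwol.{u}) (τ : X.V) : Type u := Σ σ : X.V, X.E σ τ

/-- There is an edge path (of length at least zero, edges may be traversed in both directions)
between any two vertices. -/
def IsConnected (X : Scwol.{u}) : Prop :=
  ∀ σ τ : X.V,
    Relation.ReflTransGen (fun ρ υ => Nonempty (X.E ρ υ) ∨ Nonempty (X.E υ ρ)) σ τ

/-- A (non-degenerate) morphism of scwols: it maps the edges issuing from `σ` bijectively to the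
edges issuing from the image of `σ`. -/
@[ext]
structure Hom (X Y : Scwol.{u}) where
  onV : X.V → Y.V
  onE : ∀ {σ τ : X.V}, X.E σ τ → Y.E (onV σ) (onV τ)
  map_comp : ∀ {ρ σ τ : X.V} (a : X.E σ τ) (b : X.E ρ σ),
    onE (X.comp a b) = Y.comp (onE a) (onE b)
  bijective_out : ∀ σ : X.V, Function.Bijective
    (fun a : X.OutEdge σ => (⟨onV a.1, onE a.2⟩ : Y.OutEdge (onV σ)))

namespace Hom

variable {X Y Z : Scwol.{u}}

/-- The map on all edges. -/
def mapEdge (f : Hom X Y) (a : X.Edge) : Y.Edge := ⟨f.onV a.1, f.onV a.2.1, f.onE a.2.2⟩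

/-- The map on the edges with a given terminal vertex. -/
def mapIn (f : Hom X Y) {σ : X.V} (a : X.InEdge σ) : Y.InEdge (f.onV σ) :=
  ⟨f.onV a.1, f.onE a.2⟩

/-- The map is surjective on vertices and on edges. -/
def IsSurjective (f : Hom X Y) : Prop :=
  Function.Surjective f.onV ∧ Function.Surjective f.mapEdge

/-- The map is bijective on vertices and on edges; its inverse is then a morphism too. -/
def IsIso (f : Hom X Y) : Prop :=
  Function.Bijective f.onV ∧ Function.Bijective f.mapEdge

/-- The identity morphism. -/
def id (X : Scwol.{u}) : Hom X X where
  onV σ := σ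
  onE a := a
  map_comp _ _ := rfl
  bijective_out _ := Function.bijective_id

/-- The composition `g ∘ f`. -/
abbrev comp (g : Hom Y Z) (f : Hom X Y) : Hom X Z where
  onV σ := g.onV (f.onV σ)
  onE a := g.onE (f.onE a)
  map_comp a b := by rw [f.map_comp, g.map_comp]
  bijective_out σ := (g.bijective_out (f.onV σ)).comp (f.bijective_out σ)

/-- The endomorphisms of `X` form a monoid; its units are the automorphisms of `X`. -/
instance : Monoid (Hom X X) where
  mul g f := g.comp f
  one := Hom.id X
  mul_assoc _ _ _ := rfl
  one_mul _ := rfl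
  mul_one _ := rfl

/-- Distinct edges with the same initial vertex have distinct images. -/
theorem out_unique (f : Hom X Y) {σ τ τ' : X.V} (a : X.E σ τ) (b : X.E σ τ')
    (h : f.mapEdge ⟨σ, τ, a⟩ = f.mapEdge ⟨σ, τ', b⟩) : τ = τ' := by
  have h1 : (⟨τ, a⟩ : X.OutEdge σ) = ⟨τ', b⟩ := by
    apply (f.bijective_out σ).1
    simp only [mapEdge, Sigma.mk.injEq, heq_eq_eq, true_and] at h
    simpa using h
  exact congrArg Sigma.fst h1

theorem mapEdge_comp (f : Hom X Y) {x y y' z : X.V} {ρ σ τ : Y.V} (b : X.E x y) (a : X.E y' z)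
    (b' : Y.E ρ σ) (a' : Y.E σ τ) (hy : y = y') (hb : f.mapEdge ⟨x, y, b⟩ = ⟨ρ, σ, b'⟩)
    (ha : f.mapEdge ⟨y', z, a⟩ = ⟨σ, τ, a'⟩) :
    ∃ c : X.E x z, f.mapEdge ⟨x, z, c⟩ = ⟨ρ, τ, Y.comp a' b'⟩ := by
  subst hy
  refine ⟨X.comp a b, ?_⟩
  simp only [mapEdge] at *
  cases hb
  simp only [Sigma.mk.injEq, heq_eq_eq, true_and] at ha
  obtain ⟨h1, h2⟩ := ha
  subst h1
  cases h2
  rw [f.map_comp]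

end Hom

/-- An action of a group on a scwol by automorphisms (a homomorphism from a group to the monoid of
endomorphisms takes values in the automorphisms). -/
structure Action (G : Type u) [Group G] (W : Scwol.{u}) where
  toEnd : G →* Hom W W
  map_init_ne : ∀ (g : G) {σ τ : W.V}, W.E σ τ → (toEnd g).onV σ ≠ τ
  map_eq_of_fix : ∀ (g : G) {σ τ : W.V} (a : W.E σ τ),
    (toEnd g).onV σ = σ → (toEnd g).mapEdge ⟨σ, τ, a⟩ = ⟨σ, τ, a⟩

namespace Action

variable {G : Type u} [Group G] {W Z : Scwol.{u}}

theorem mul_onV (A : Action G W) (g h : G) (σ : W.V) :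
    (A.toEnd (g * h)).onV σ = (A.toEnd g).onV ((A.toEnd h).onV σ) := by
  rw [map_mul]; rfl

theorem one_onV (A : Action G W) (σ : W.V) : (A.toEnd 1).onV σ = σ := by
  rw [map_one]; rfl

theorem inv_onV (A : Action G W) {g : G} {σ τ : W.V} (h : (A.toEnd g).onV σ = τ) :
    (A.toEnd g⁻¹).onV τ = σ := by
  rw [← h, ← mul_onV, inv_mul_cancel, one_onV]

/-- The isotropy subgroup of a vertex. -/
def isotropy (A : Action G W) (σ : W.V) : Subgroup G where
  carrier := {g | (A.toEnd g).onV σ = σ}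
  mul_mem' {g h} hg hh := by
    simp only [Set.mem_ofPred_eq] at *
    rw [mul_onV, hh, hg]
  one_mem' := A.one_onV σ
  inv_mem' hg := A.inv_onV hg

/-- `p` exhibits `Z` as the quotient scwol `W / G`: it is surjective and its fibres, on vertices
and on edges, are the orbits of `G`. -/
structure IsQuotient (A : Action G W) (p : Hom W Z) : Prop where
  surjective : p.IsSurjective
  vertex_orbit : ∀ σ σ' : W.V, p.onV σ = p.onV σ' ↔ ∃ g : G, (A.toEnd g).onV σ = σ'
  edge_orbit : ∀ a a' : W.Edge, p.mapEdge a = p.mapEdge a' ↔ ∃ g : G, (A.toEnd g).mapEdge a = a'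

/-- The choices that enter into the complex of groups associated to an action: a lift `lift σ` of
each vertex `σ` of the quotient, for each edge `a` with `i(a) = σ` its lift `liftEdge a` that issues
from `lift σ` (there is exactly one; `liftEnd a` is its terminal vertex), and an element `h a` of the
group that maps the terminal vertex of `liftEdge a` to the chosen lift of `t(a)`. -/
structure Choices (A : Action G W) (p : Hom W Z) where
  lift : Z.V → W.V
  p_lift : ∀ σ : Z.V, p.onV (lift σ) = σ
  liftEnd : ∀ {σ τ : Z.V}, Z.E σ τ → W.V
  liftEdge : ∀ {σ τ : Z.V} (a : Z.E σ τ), W.E (lift σ) (liftEnd a)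
  p_liftEdge : ∀ {σ τ : Z.V} (a : Z.E σ τ),
    p.mapEdge ⟨lift σ, liftEnd a, liftEdge a⟩ = ⟨σ, τ, a⟩
  h : ∀ {σ τ : Z.V}, Z.E σ τ → G
  h_liftEnd : ∀ {σ τ : Z.V} (a : Z.E σ τ), (A.toEnd (h a)).onV (liftEnd a) = lift τ

theorem Choices.boundary_mem {A : Action G W} {p : Hom W Z} (c : A.Choices p) {σ τ : Z.V}
    (a : Z.E σ τ) {g : G} (hg : g ∈ A.isotropy (c.lift σ)) :
    c.h a * g * (c.h a)⁻¹ ∈ A.isotropy (c.lift τ) := by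
  have h1 := A.map_eq_of_fix g (c.liftEdge a) hg
  have h2 : (A.toEnd g).onV (c.liftEnd a) = c.liftEnd a := congrArg (fun e => e.2.1) h1
  change (A.toEnd _).onV _ = _
  rw [mul_onV, mul_onV, A.inv_onV (c.h_liftEnd a), h2, c.h_liftEnd]

theorem Choices.twist_mem {A : Action G W} {p : Hom W Z} (hp : A.IsQuotient p) (c : A.Choices p)
    {ρ σ τ : Z.V} (a : Z.E σ τ) (b : Z.E ρ σ) :
    c.h a * c.h b * (c.h (Z.comp a b))⁻¹ ∈ A.isotropy (c.lift τ) := by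
  have h1 : p.mapEdge ((A.toEnd (c.h b)⁻¹).mapEdge ⟨_, _, c.liftEdge a⟩) = ⟨σ, τ, a⟩ := by
    rw [← c.p_liftEdge a]
    exact ((hp.edge_orbit _ _).2 ⟨_, rfl⟩).symm
  obtain ⟨e, he⟩ := p.mapEdge_comp (c.liftEdge b) ((A.toEnd (c.h b)⁻¹).onE (c.liftEdge a)) b a
    (A.inv_onV (c.h_liftEnd b)).symm (c.p_liftEdge b) h1
  have h2 := p.out_unique _ _ ((c.p_liftEdge (Z.comp a b)).trans he.symm)
  change (A.toEnd _).onV _ = _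
  rw [mul_onV, A.inv_onV (c.h_liftEnd (Z.comp a b)), h2, ← mul_onV, mul_assoc, mul_inv_cancel,
    mul_one, c.h_liftEnd]

end Action

end Scwol

/-! ### Complexes of groups -/

/-- A complex of groups over the scwol `X`: local groups `grp σ`, boundary monomorphisms `bd a` and
twisting elements `tw a b`. -/
structure ComplexOfGroups (X : Scwol.{u}) where
  grp : X.V → Type u
  [group : ∀ σ, Group (grp σ)]
  bd : ∀ {σ τ : X.V}, X.E σ τ → grp σ →* grp τ
  bd_injective : ∀ {σ τ : X.V} (a : X.E σ τ), Function.Injective (bd a)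
  tw : ∀ {ρ σ τ : X.V}, X.E σ τ → X.E ρ σ → grp τ
  conj_bd : ∀ {ρ σ τ : X.V} (a : X.E σ τ) (b : X.E ρ σ) (g : grp ρ),
    tw a b * bd (X.comp a b) g * (tw a b)⁻¹ = bd a (bd b g)
  cocycle : ∀ {ρ σ τ υ : X.V} (a : X.E τ υ) (b : X.E σ τ) (c : X.E ρ σ),
    bd a (tw b c) * tw a (X.comp b c) = tw a b * tw (X.comp a b) c

/-- The complex of groups associated to an action of `G` on `W` with quotient `Z`: the local groups
are the isotropy subgroups of the chosen lifts, the boundary monomorphisms are the conjugations by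
the elements `h a`, and the twisting elements are `h a * h b * (h (ab))⁻¹`. -/
def Scwol.Action.inducedComplex {G : Type u} [Group G] {W Z : Scwol.{u}} (A : Scwol.Action G W)
    {p : Scwol.Hom W Z} (hp : A.IsQuotient p) (c : A.Choices p) : ComplexOfGroups Z where
  grp σ := A.isotropy (c.lift σ)
  bd {_ _} a :=
    { toFun := fun g => ⟨c.h a * g * (c.h a)⁻¹, c.boundary_mem a g.2⟩
      map_one' := by ext; simp
      map_mul' := fun g g' => by ext; simp }
  bd_injective a g g' hgg := by
    ext
    simpa using congrArg Subtype.val hgg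
  tw a b := ⟨c.h a * c.h b * (c.h (Z.comp a b))⁻¹, c.twist_mem hp a b⟩
  conj_bd a b g := by
    ext
    simp [mul_assoc]
  cocycle a b d := by
    ext
    simp [mul_assoc, Z.assoc]

namespace ComplexOfGroups

attribute [instance] ComplexOfGroups.group

variable {X Y Z : Scwol.{u}}

/-! ### Morphisms -/

/-- The local homomorphisms `loc σ` and the edge elements `elt a` of a morphism of complexes of
groups over the morphism of scwols `f`. -/
structure HomOver (f : Scwol.Hom X Y) (𝕏 : ComplexOfGroups X) (𝕐 : ComplexOfGroups Y) where
  loc : ∀ σ : X.V, 𝕏.grp σ →* 𝕐.grp (f.onV σ)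
  elt : ∀ {σ τ : X.V}, X.E σ τ → 𝕐.grp (f.onV τ)
  conj_loc : ∀ {σ τ : X.V} (a : X.E σ τ) (g : 𝕏.grp σ),
    elt a * 𝕐.bd (f.onE a) (loc σ g) * (elt a)⁻¹ = loc τ (𝕏.bd a g)
  loc_tw : ∀ {ρ σ τ : X.V} (a : X.E σ τ) (b : X.E ρ σ),
    loc τ (𝕏.tw a b) * elt (X.comp a b) =
      elt a * 𝕐.bd (f.onE a) (elt b) * 𝕐.tw (f.onE a) (f.onE b)

/-- A morphism of complexes of groups. -/
structure Hom (𝕏 : ComplexOfGroups X) (𝕐 : ComplexOfGroups Y) where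
  base : Scwol.Hom X Y
  data : HomOver base 𝕏 𝕐

/-- The composition `η ∘ φ` of morphisms of complexes of groups. -/
def Hom.comp {𝕏 : ComplexOfGroups X} {𝕐 : ComplexOfGroups Y} {ℤ' : ComplexOfGroups Z}
    (η : Hom 𝕐 ℤ') (φ : Hom 𝕏 𝕐) : Hom 𝕏 ℤ' where
  base := η.base.comp φ.base
  data :=
    { loc := fun σ => (η.data.loc (φ.base.onV σ)).comp (φ.data.loc σ)
      elt := fun {_ τ} a => η.data.loc (φ.base.onV τ) (φ.data.elt a) * η.data.elt (φ.base.onE a)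
      conj_loc := fun {σ τ} a g => by
        have h := η.data.conj_loc (φ.base.onE a) (φ.data.loc σ g)
        change η.data.loc _ (φ.data.elt a) * η.data.elt (φ.base.onE a) *
          ℤ'.bd (η.base.onE (φ.base.onE a)) (η.data.loc _ (φ.data.loc σ g)) *
          (η.data.loc _ (φ.data.elt a) * η.data.elt (φ.base.onE a))⁻¹ =
            η.data.loc _ (φ.data.loc τ (𝕏.bd a g))
        rw [← φ.data.conj_loc, map_mul, map_mul, map_inv, ← h]
        group
      loc_tw := fun {ρ σ τ} a b => by
        have h1 := congrArg (η.data.loc _) (φ.data.loc_tw a b)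
        have h2 := η.data.loc_tw (φ.base.onE a) (φ.base.onE b)
        have h3 := η.data.conj_loc (φ.base.onE a) (φ.data.elt b)
        simp only [map_mul] at h1
        change η.data.loc _ (φ.data.loc τ (𝕏.tw a b)) * (η.data.loc _ (φ.data.elt (X.comp a b)) *
            η.data.elt (φ.base.onE (X.comp a b))) =
          η.data.loc _ (φ.data.elt a) * η.data.elt (φ.base.onE a) *
            ℤ'.bd (η.base.onE (φ.base.onE a))
              (η.data.loc _ (φ.data.elt b) * η.data.elt (φ.base.onE b)) *
            ℤ'.tw (η.base.onE (φ.base.onE a)) (η.base.onE (φ.base.onE b))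
        rw [φ.base.map_comp, ← mul_assoc, h1, mul_assoc (_ * _), h2, ← h3, map_mul]
        group }

/-- An isomorphism of complexes of groups: the underlying morphism of scwols and all local
homomorphisms are isomorphisms. -/
def Hom.IsIso {𝕏 : ComplexOfGroups X} {𝕐 : ComplexOfGroups Y} (φ : Hom 𝕏 𝕐) : Prop :=
  φ.base.IsIso ∧ ∀ σ : X.V, Function.Bijective (φ.data.loc σ)

/-- The family `k` is a homotopy from `φ` to `η`, two morphisms over the same morphism of scwols. -/
def HomOver.IsHomotopy {f : Scwol.Hom X Y} {𝕏 : ComplexOfGroups X} {𝕐 : ComplexOfGroups Y}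
    (φ η : HomOver f 𝕏 𝕐) (k : ∀ σ : X.V, 𝕐.grp (f.onV σ)) : Prop :=
  (∀ (σ : X.V) (g : 𝕏.grp σ), η.loc σ g = k σ * φ.loc σ g * (k σ)⁻¹) ∧
  ∀ {σ τ : X.V} (a : X.E σ τ), η.elt a = k τ * φ.elt a * 𝕐.bd (f.onE a) (k σ)⁻¹

/-- `φ` and `η` are homotopic relative to the vertex `σ₀`: they lie over the same morphism of scwols
and there is a homotopy from `φ` to `η` that is trivial at `σ₀`. -/
def Hom.HomotopicRel {𝕏 : ComplexOfGroups X} {𝕐 : ComplexOfGroups Y} (σ₀ : X.V)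
    (φ η : Hom 𝕏 𝕐) : Prop :=
  ∃ (h : φ.base = η.base) (k : ∀ σ : X.V, 𝕐.grp (η.base.onV σ)),
    HomOver.IsHomotopy (h ▸ φ.data) η.data k ∧ k σ₀ = 1

/-- A complex of groups is developable if it is isomorphic to the complex of groups associated to
an action of a group on a scwol. -/
def IsDevelopable (𝕏 : ComplexOfGroups X) : Prop :=
  ∃ (G : Type u) (_ : Group G) (W Z : Scwol.{u}) (A : Scwol.Action G W) (p : Scwol.Hom W Z)
    (hp : A.IsQuotient p) (c : A.Choices p) (φ : Hom 𝕏 (A.inducedComplex hp c)), φ.IsIso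

/-! ### Coverings -/

/-- The map
`∐_{a ∈ f⁻¹(a'), t(a) = σ} G_σ / ψ_a(G_{i(a)}) → G_{f(σ)} / ψ_{a'}(G_{i(a')})`
sending the coset of `g` with index `a` to the coset of `φ_σ(g) φ(a)`. -/
def Hom.cosetMap {𝕏 : ComplexOfGroups X} {𝕐 : ComplexOfGroups Y} (φ : Hom 𝕏 𝕐) (σ : X.V)
    (a' : Y.InEdge (φ.base.onV σ)) :
    (Σ a : {a : X.InEdge σ // φ.base.mapIn a = a'}, 𝕏.grp σ ⧸ (𝕏.bd a.1.2).range) →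
      𝕐.grp (φ.base.onV σ) ⧸ (𝕐.bd a'.2).range :=
  fun x => Quotient.map' (fun g => φ.data.loc σ g * φ.data.elt x.1.1.2)
    (by
      obtain ⟨⟨⟨ρ, a⟩, ha⟩, q⟩ := x
      subst ha
      intro g g' hgg
      rw [QuotientGroup.leftRel_apply] at hgg ⊢
      obtain ⟨k, hk⟩ := hgg
      refine ⟨φ.data.loc ρ k, ?_⟩
      have h1 := φ.data.conj_loc a k
      have h2 : φ.data.loc σ g' = φ.data.loc σ g * φ.data.loc σ (𝕏.bd a k) := by
        rw [hk, ← map_mul, mul_inv_cancel_left]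
      simp only [Scwol.Hom.mapIn] at *
      rw [h2, ← h1, mul_inv_rev]
      simp only [mul_assoc, inv_mul_cancel_left, inv_mul_cancel, mul_one]
      rfl) x.2

/-- Coverings of complexes of groups. -/
structure Hom.IsCovering {𝕏 : ComplexOfGroups X} {𝕐 : ComplexOfGroups Y} (φ : Hom 𝕏 𝕐) :
    Prop where
  surjective : φ.base.IsSurjective
  loc_injective : ∀ σ : X.V, Function.Injective (φ.data.loc σ)
  coset_bijective : ∀ (σ : X.V) (a' : Y.InEdge (φ.base.onV σ)),
    Function.Bijective (φ.cosetMap σ a')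

/-! ### Paths and the fundamental group -/

/-- `𝕏`-paths `(g₀, e₁, g₁, …, eₙ, gₙ)` from `σ` to `τ`: `nil g` is the path `(g)` of length zero,
`fwd g a p` is `(g, a, p)` and `bwd g a p` is `(g, a⁻¹, p)` for an edge `a`. -/
inductive Path (𝕏 : ComplexOfGroups X) : X.V → X.V → Type u
  | nil {σ : X.V} (g : 𝕏.grp σ) : Path 𝕏 σ σ
  | fwd {σ τ υ : X.V} (g : 𝕏.grp σ) (a : X.E σ τ) (p : Path 𝕏 τ υ) : Path 𝕏 σ υ
  | bwd {σ τ υ : X.V} (g : 𝕏.grp τ) (a : X.E σ τ) (p : Path 𝕏 σ υ) : Path 𝕏 τ υ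

namespace Path

variable {𝕏 : ComplexOfGroups X} {𝕐 : ComplexOfGroups Y}

/-- Multiply the first group element of a path by `g` on the left. -/
def lmul : ∀ {σ τ : X.V}, 𝕏.grp σ → 𝕏.Path σ τ → 𝕏.Path σ τ
  | _, _, g, nil g' => nil (g * g')
  | _, _, g, fwd g' a p => fwd (g * g') a p
  | _, _, g, bwd g' a p => bwd (g * g') a p

@[simp] theorem lmul_nil {σ : X.V} (g g' : 𝕏.grp σ) : (nil g').lmul g = nil (g * g') := rfl

@[simp] theorem lmul_fwd {σ τ υ : X.V} (g g' : 𝕏.grp σ) (a : X.E σ τ) (p : 𝕏.Path τ υ) :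
    (fwd g' a p).lmul g = fwd (g * g') a p := rfl

@[simp] theorem lmul_bwd {σ τ υ : X.V} (g g' : 𝕏.grp τ) (a : X.E σ τ) (p : 𝕏.Path σ υ) :
    (bwd g' a p).lmul g = bwd (g * g') a p := rfl

/-- The concatenation `p ⋆ q`. -/
def concat : ∀ {σ τ υ : X.V}, 𝕏.Path σ τ → 𝕏.Path τ υ → 𝕏.Path σ υ
  | _, _, _, nil g, q => q.lmul g
  | _, _, _, fwd g a p, q => fwd g a (p.concat q)
  | _, _, _, bwd g a p, q => bwd g a (p.concat q)

/-- The inverse path. -/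
def inv : ∀ {σ τ : X.V}, 𝕏.Path σ τ → 𝕏.Path τ σ
  | _, _, nil g => nil g⁻¹
  | _, _, fwd g a p => p.inv.concat (bwd 1 a (nil g⁻¹))
  | _, _, bwd g a p => p.inv.concat (fwd 1 a (nil g⁻¹))

/-- The moves of elementary equivalence: edge slides, reductions and shortcuts. -/
inductive Move : ∀ {σ τ : X.V}, 𝕏.Path σ τ → 𝕏.Path σ τ → Prop
  | slideFwd {σ τ : X.V} (a : X.E σ τ) (k g : 𝕏.grp σ) (h : 𝕏.grp τ) :
      Move (fwd (k * g) a (nil h)) (fwd k a (nil (𝕏.bd a g * h)))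
  | slideBwd {σ τ : X.V} (a : X.E σ τ) (g : 𝕏.grp τ) (h k : 𝕏.grp σ) :
      Move (bwd g a (nil (h * k))) (bwd (g * 𝕏.bd a h) a (nil k))
  | reduceFwd {σ τ : X.V} (a : X.E σ τ) (g h k : 𝕏.grp σ) :
      Move (fwd g a (bwd (𝕏.bd a h) a (nil k))) (nil (g * h * k))
  | reduceBwd {σ τ : X.V} (b : X.E σ τ) (g k : 𝕏.grp τ) (h : 𝕏.grp σ) :
      Move (bwd g b (fwd h b (nil k))) (nil (g * 𝕏.bd b h * k))
  | shortFwd {ρ σ τ : X.V} (a : X.E σ τ) (b : X.E ρ σ) (g : 𝕏.grp ρ) (k : 𝕏.grp τ) :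
      Move (fwd g b (fwd 1 a (nil k))) (fwd g (X.comp a b) (nil ((𝕏.tw a b)⁻¹ * k)))
  | shortBwd {ρ σ τ : X.V} (a : X.E σ τ) (b : X.E ρ σ) (g : 𝕏.grp τ) (k : 𝕏.grp ρ) :
      Move (bwd g a (bwd 1 b (nil k))) (bwd (g * 𝕏.tw a b) (X.comp a b) (nil k))

/-- Apply a move to a subpath. -/
inductive Step {σ τ : X.V} : 𝕏.Path σ τ → 𝕏.Path σ τ → Prop
  | mk {σ' τ' : X.V} (p : 𝕏.Path σ σ') {s s' : 𝕏.Path σ' τ'} (h : Move s s') (q : 𝕏.Path τ' τ) :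
      Step (p.concat (s.concat q)) (p.concat (s'.concat q))

/-- Homotopy of `𝕏`-paths: a finite sequence of moves and inverse moves on subpaths. -/
def Homotopic {σ τ : X.V} (p q : 𝕏.Path σ τ) : Prop := Relation.EqvGen Step p q

theorem lmul_one {σ τ : X.V} (p : 𝕏.Path σ τ) : p.lmul 1 = p := by
  cases p <;> simp

theorem lmul_lmul {σ τ : X.V} (g h : 𝕏.grp σ) (p : 𝕏.Path σ τ) :
    (p.lmul h).lmul g = p.lmul (g * h) := by
  cases p <;> simp [mul_assoc]

theorem lmul_concat {σ τ υ : X.V} (g : 𝕏.grp σ) (p : 𝕏.Path σ τ) (q : 𝕏.Path τ υ) :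
    (p.lmul g).concat q = (p.concat q).lmul g := by
  cases p <;> simp [concat, lmul_lmul]

theorem concat_assoc {σ τ υ ω : X.V} (p : 𝕏.Path σ τ) (q : 𝕏.Path τ υ) (r : 𝕏.Path υ ω) :
    (p.concat q).concat r = p.concat (q.concat r) := by
  induction p with
  | nil g => simp [concat, lmul_concat]
  | fwd g a p ih => simp [concat, ih]
  | bwd g a p ih => simp [concat, ih]

theorem one_concat {σ τ : X.V} (p : 𝕏.Path σ τ) : (nil (1 : 𝕏.grp σ)).concat p = p := by
  simp [concat, lmul_one]

theorem concat_one {σ τ : X.V} (p : 𝕏.Path σ τ) : p.concat (nil (1 : 𝕏.grp τ)) = p := by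
  induction p with
  | nil g => simp [concat]
  | fwd g a p ih => simp [concat, ih]
  | bwd g a p ih => simp [concat, ih]

theorem Homotopic.refl {σ τ : X.V} (p : 𝕏.Path σ τ) : Homotopic p p :=
  Relation.EqvGen.refl p

theorem Homotopic.symm {σ τ : X.V} {p q : 𝕏.Path σ τ} (h : Homotopic p q) : Homotopic q p :=
  Relation.EqvGen.symm _ _ h

theorem Homotopic.trans {σ τ : X.V} {p q r : 𝕏.Path σ τ} (h : Homotopic p q)
    (h' : Homotopic q r) : Homotopic p r := Relation.EqvGen.trans _ _ _ h h'

theorem Move.homotopic {σ τ : X.V} {p q : 𝕏.Path σ τ} (h : Move p q) : Homotopic p q := by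
  have := Step.mk (nil 1) h (nil 1)
  rw [one_concat, one_concat, concat_one, concat_one] at this
  exact .rel _ _ this

theorem Homotopic.concat_left {σ τ υ : X.V} (r : 𝕏.Path σ τ) {p q : 𝕏.Path τ υ}
    (h : Homotopic p q) : Homotopic (r.concat p) (r.concat q) := by
  induction h with
  | rel _ _ h =>
    obtain ⟨p, m, q⟩ := h
    rw [← concat_assoc r, ← concat_assoc r]
    exact .rel _ _ (.mk _ m _)
  | refl => exact .refl _
  | symm _ _ _ ih => exact ih.symm
  | trans _ _ _ _ _ ih ih' => exact ih.trans ih'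

theorem Homotopic.concat_right {σ τ υ : X.V} {p q : 𝕏.Path σ τ} (h : Homotopic p q)
    (r : 𝕏.Path τ υ) : Homotopic (p.concat r) (q.concat r) := by
  induction h with
  | rel _ _ h =>
    obtain ⟨p, m, q⟩ := h
    rw [concat_assoc, concat_assoc, concat_assoc, concat_assoc]
    exact .rel _ _ (.mk _ m _)
  | refl => exact .refl _
  | symm _ _ _ ih => exact ih.symm
  | trans _ _ _ _ _ ih ih' => exact ih.trans ih'

theorem Homotopic.concat {σ τ υ : X.V} {p p' : 𝕏.Path σ τ} {q q' : 𝕏.Path τ υ}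
    (h : Homotopic p p') (h' : Homotopic q q') : Homotopic (p.concat q) (p'.concat q') :=
  (h.concat_right q).trans (h'.concat_left p')

theorem inv_concat_self {σ τ : X.V} (p : 𝕏.Path σ τ) : Homotopic (p.inv.concat p) (nil 1) := by
  induction p with
  | nil g =>
    simp only [inv, Path.concat, lmul_nil, inv_mul_cancel]
    exact .refl _
  | fwd g a p ih =>
    simp only [inv, concat_assoc]
    refine (Homotopic.concat_left _ ?_).trans ih
    have := ((Move.reduceBwd a 1 1 1).homotopic.concat_right p)
    simpa [Path.concat, lmul_one] using this
  | bwd g a p ih =>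
    simp only [inv, concat_assoc]
    refine (Homotopic.concat_left _ ?_).trans ih
    have := ((Move.reduceFwd a 1 1 1).homotopic.concat_right p)
    simpa [Path.concat, lmul_one] using this

theorem concat_inv_self {σ τ : X.V} (p : 𝕏.Path σ τ) : Homotopic (p.concat p.inv) (nil 1) := by
  induction p with
  | nil g =>
    simp only [inv, Path.concat, lmul_nil, mul_inv_cancel]
    exact .refl _
  | fwd g a p ih =>
    have h1 : (fwd g a p).concat (fwd g a p).inv =
        (fwd g a (nil 1)).concat ((p.concat p.inv).concat (bwd 1 a (nil g⁻¹))) := by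
      simp [inv, Path.concat, concat_assoc, lmul_one]
    rw [h1]
    refine ((ih.concat_right _).concat_left _).trans ?_
    have := (Move.reduceFwd a g 1 g⁻¹).homotopic
    simpa [Path.concat, lmul_one] using this
  | bwd g a p ih =>
    have h1 : (bwd g a p).concat (bwd g a p).inv =
        (bwd g a (nil 1)).concat ((p.concat p.inv).concat (fwd 1 a (nil g⁻¹))) := by
      simp [inv, Path.concat, concat_assoc, lmul_one]
    rw [h1]
    refine ((ih.concat_right _).concat_left _).trans ?_
    have := (Move.reduceBwd a g g⁻¹ 1).homotopic
    simpa [Path.concat, lmul_one] using this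

theorem Homotopic.inv {σ τ : X.V} {p q : 𝕏.Path σ τ} (h : Homotopic p q) :
    Homotopic p.inv q.inv := by
  have h1 : Homotopic (p.inv.concat (q.concat q.inv)) p.inv := by
    simpa [concat_one] using (concat_inv_self q).concat_left p.inv
  have h2 : Homotopic ((p.inv.concat p).concat q.inv) q.inv := by
    simpa [one_concat] using (inv_concat_self p).concat_right q.inv
  rw [concat_assoc] at h2
  exact h1.symm.trans (((h.symm.concat_right _).concat_left _).trans h2)

/-- Homotopy as a setoid. -/
def setoid (𝕏 : ComplexOfGroups X) (σ τ : X.V) : Setoid (𝕏.Path σ τ) :=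
  ⟨Homotopic, Homotopic.refl, Homotopic.symm, Homotopic.trans⟩

/-- The map `𝔭_φ` on paths induced by a morphism `φ`: multiplicative with respect to concatenation,
with `(g) ↦ (φ_σ(g))`, `(1, a, 1) ↦ (1, f(a), φ(a)⁻¹)` and `(1, a⁻¹, 1) ↦ (φ(a), f(a)⁻¹, 1)`. -/
def map (φ : Hom 𝕏 𝕐) :
    ∀ {σ τ : X.V}, 𝕏.Path σ τ → 𝕐.Path (φ.base.onV σ) (φ.base.onV τ)
  | σ, _, nil g => nil (φ.data.loc σ g)
  | σ, _, fwd g a p => (nil (φ.data.loc σ g)).concat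
      ((fwd 1 (φ.base.onE a) (nil (φ.data.elt a)⁻¹)).concat (p.map φ))
  | σ, _, bwd g a p => (nil (φ.data.loc σ g)).concat
      ((bwd (φ.data.elt a) (φ.base.onE a) (nil 1)).concat (p.map φ))

theorem map_lmul (φ : Hom 𝕏 𝕐) {σ τ : X.V} (g : 𝕏.grp σ) (p : 𝕏.Path σ τ) :
    (p.lmul g).map φ = (p.map φ).lmul (φ.data.loc σ g) := by
  cases p <;> simp [map, concat, mul_assoc]

theorem map_concat (φ : Hom 𝕏 𝕐) {σ τ υ : X.V} (p : 𝕏.Path σ τ) (q : 𝕏.Path τ υ) :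
    (p.concat q).map φ = (p.map φ).concat (q.map φ) := by
  induction p with
  | nil g => simp [concat, map, map_lmul]
  | fwd g a p ih => simp [concat, map, ih, lmul_concat]
  | bwd g a p ih => simp [concat, map, ih, lmul_concat]

theorem Move.map_homotopic (φ : Hom 𝕏 𝕐) {σ τ : X.V} {p q : 𝕏.Path σ τ} (h : Move p q) :
    Homotopic (p.map φ) (q.map φ) := by
  cases h with
  | slideFwd a k g h =>
    have := (Move.slideFwd (φ.base.onE a) (φ.data.loc _ k) (φ.data.loc _ g)
      ((φ.data.elt a)⁻¹ * φ.data.loc _ h)).homotopic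
    simp only [map, Path.concat, lmul_nil, lmul_fwd, lmul_bwd, map_mul, ← φ.data.conj_loc, mul_one]
    simpa [mul_assoc] using this
  | slideBwd a g h k =>
    have := (Move.slideBwd (φ.base.onE a) (φ.data.loc _ g * φ.data.elt a) (φ.data.loc _ h)
      (φ.data.loc _ k)).homotopic
    simp only [map, Path.concat, lmul_nil, lmul_fwd, lmul_bwd, map_mul, ← φ.data.conj_loc, mul_one]
    simpa [mul_assoc] using this
  | reduceFwd a g h k =>
    have := (Move.reduceFwd (φ.base.onE a) (φ.data.loc _ g) (φ.data.loc _ h)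
      (φ.data.loc _ k)).homotopic
    simp only [map, Path.concat, lmul_nil, lmul_fwd, lmul_bwd, map_mul, ← φ.data.conj_loc, mul_one]
    simpa [mul_assoc] using this
  | reduceBwd b g k h =>
    have := (Move.reduceBwd (φ.base.onE b) (φ.data.loc _ g * φ.data.elt b)
      ((φ.data.elt b)⁻¹ * φ.data.loc _ k) (φ.data.loc _ h)).homotopic
    simp only [map, Path.concat, lmul_nil, lmul_fwd, lmul_bwd, map_mul, ← φ.data.conj_loc, mul_one]
    simpa [mul_assoc] using this
  | shortFwd a b g k =>
    have h0 : (φ.data.elt (X.comp a b))⁻¹ * (φ.data.loc _ (𝕏.tw a b))⁻¹ =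
        (𝕐.tw (φ.base.onE a) (φ.base.onE b))⁻¹ *
          ((𝕐.bd (φ.base.onE a) (φ.data.elt b))⁻¹ * (φ.data.elt a)⁻¹) := by
      rw [← mul_inv_rev, φ.data.loc_tw]
      simp [mul_assoc]
    have h1 := ((Move.slideFwd (φ.base.onE a) 1 (φ.data.elt b)⁻¹
      ((φ.data.elt a)⁻¹ * φ.data.loc _ k)).homotopic).concat_left
        (fwd (φ.data.loc _ g) (φ.base.onE b) (nil 1))
    have h2 := (Move.shortFwd (φ.base.onE a) (φ.base.onE b) (φ.data.loc _ g)
      ((𝕐.bd (φ.base.onE a) (φ.data.elt b)⁻¹) * ((φ.data.elt a)⁻¹ * φ.data.loc _ k))).homotopic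
    simp only [map, Path.concat, lmul_nil, lmul_fwd, lmul_bwd, map_mul, map_inv, map_one, mul_one, one_mul,
      φ.base.map_comp] at h1 h2 ⊢
    rw [← mul_assoc _ _ (φ.data.loc _ k), h0]
    simpa [mul_assoc] using h1.trans h2
  | shortBwd a b g k =>
    have h0 := φ.data.loc_tw a b
    have h1 := ((Move.slideBwd (φ.base.onE a) (φ.data.loc _ g * φ.data.elt a)
      (φ.data.elt b) 1).homotopic).concat_right
        (bwd 1 (φ.base.onE b) (nil (φ.data.loc _ k)))
    have h2 := (Move.shortBwd (φ.base.onE a) (φ.base.onE b)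
      (φ.data.loc _ g * φ.data.elt a * 𝕐.bd (φ.base.onE a) (φ.data.elt b))
      (φ.data.loc _ k)).homotopic
    simp only [map, Path.concat, lmul_nil, lmul_fwd, lmul_bwd, map_mul, map_inv, map_one, mul_one, one_mul,
      φ.base.map_comp] at h1 h2 ⊢
    rw [mul_assoc _ _ (φ.data.elt (X.comp a b)), h0]
    simpa [mul_assoc] using h1.trans h2

theorem Homotopic.map (φ : Hom 𝕏 𝕐) {σ τ : X.V} {p q : 𝕏.Path σ τ} (h : Homotopic p q) :
    Homotopic (p.map φ) (q.map φ) := by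
  induction h with
  | rel _ _ h =>
    obtain ⟨p, m, q⟩ := h
    simp only [map_concat]
    exact ((m.map_homotopic φ).concat_right _).concat_left _
  | refl => exact .refl _
  | symm _ _ _ ih => exact ih.symm
  | trans _ _ _ _ _ ih ih' => exact ih.trans ih'

end Path

/-- The fundamental group `π₁(𝕏, σ₀)`: homotopy classes of `𝕏`-loops at `σ₀`. -/
def Pi1 (𝕏 : ComplexOfGroups X) (σ₀ : X.V) : Type u := Quotient (Path.setoid 𝕏 σ₀ σ₀)

/-- The product is induced by concatenation. -/
instance (𝕏 : ComplexOfGroups X) (σ₀ : X.V) : Group (𝕏.Pi1 σ₀) where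
  mul := Quotient.map₂ Path.concat (fun _ _ h _ _ h' => h.concat h')
  one := Quotient.mk _ (Path.nil 1)
  inv := Quotient.map Path.inv (fun _ _ h => h.inv)
  mul_assoc := by
    rintro ⟨p⟩ ⟨q⟩ ⟨r⟩
    exact congrArg (Quotient.mk _) (Path.concat_assoc p q r)
  one_mul := by
    rintro ⟨p⟩
    exact congrArg (Quotient.mk _) (Path.one_concat p)
  mul_one := by
    rintro ⟨p⟩
    exact congrArg (Quotient.mk _) (Path.concat_one p)
  inv_mul_cancel := by
    rintro ⟨p⟩
    exact Quotient.sound (Path.inv_concat_self p)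

/-- The homomorphism `π₁(𝕏, σ₀) → π₁(𝕐, f(σ₀))`, `[p] ↦ [𝔭_φ(p)]`, induced by a morphism `φ`. -/
def Hom.pi1Hom {𝕏 : ComplexOfGroups X} {𝕐 : ComplexOfGroups Y} (φ : Hom 𝕏 𝕐) (σ₀ : X.V) :
    𝕏.Pi1 σ₀ →* 𝕐.Pi1 (φ.base.onV σ₀) where
  toFun := Quotient.map (Path.map φ) (fun _ _ h => h.map φ)
  map_one' := congrArg (Quotient.mk _)
    (by simp [Path.map] : (Path.nil 1 : 𝕏.Path σ₀ σ₀).map φ = Path.nil 1)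
  map_mul' := by
    rintro ⟨p⟩ ⟨q⟩
    exact congrArg (Quotient.mk _) (Path.map_concat φ p q)

/-- The homomorphism `π₁(𝕏, σ₀) → π₁(𝕐, τ₀)` induced by a morphism `φ : (𝕏, σ₀) → (𝕐, τ₀)`. -/
def Hom.pi1Map {𝕏 : ComplexOfGroups X} {𝕐 : ComplexOfGroups Y} (φ : Hom 𝕏 𝕐) {σ₀ : X.V}
    {τ₀ : Y.V} (h : φ.base.onV σ₀ = τ₀) : 𝕏.Pi1 σ₀ →* 𝕐.Pi1 τ₀ :=
  h ▸ φ.pi1Hom σ₀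

/-- The characteristic subgroup `φ_*(π₁(𝕏, σ₀)) ≤ π₁(𝕐, τ₀)` of `φ : (𝕏, σ₀) → (𝕐, τ₀)`. -/
def Hom.charSubgroup {𝕏 : ComplexOfGroups X} {𝕐 : ComplexOfGroups Y} (φ : Hom 𝕏 𝕐) {σ₀ : X.V}
    {τ₀ : Y.V} (h : φ.base.onV σ₀ = τ₀) : Subgroup (𝕐.Pi1 τ₀) :=
  (φ.pi1Map h).range

end ComplexOfGroups

/-! The proof is classical covering theory by monodromy. A morphism φ over f has a fibre over each
vertex y of Y: pairs of a vertex x over y and a coset of φ_x(G_x) in G_y. Local groups act on fibres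
by right multiplication. An edge a lifts uniquely from each x over i(a) and sends the coset of k to
that of φ(b)ψ_a(k), where b is the lift. For a covering the coset condition says exactly that edges
act bijectively (`edge_bijective`), so formal inverse edges act too, and the relations of π₁ hold
for this action (`pathAct_homotopic`).

Over the base vertex, the stabilizer of the base point is the characteristic subgroup
(`pathAct_base_eq_iff`, by path lifting), and connectedness makes every fibre point reachable from
the base point. Hence equal characteristic subgroups yield an equivariant bijection Θ of fibres that
matches base points (`exists_map_base`, `leftInverse`).

Finally, Θ carries the trivial coset at x to a coset of some g_x at a vertex η(x). Equivariance
under local groups shows that conjugation by g_x maps the image of φ₁ at x into that of φ₂ at η(x),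
and injectivity of Θ makes it onto. Equivariance under edges produces the edge map and the edge
elements. Since φ₂ is injective on local groups, these data form an isomorphism, and the elements
g_x⁻¹ form the homotopy (`exists_isIso_of_fiberMap`). -/

namespace ComplexOfGroups

variable {X Y : Scwol.{u}} {𝕏 : ComplexOfGroups X} {𝕐 : ComplexOfGroups Y}

/-! ### The monodromy action on the fibres of a covering -/

/-- Elements `k` of the groups `G_{f(x)}` with `f(x) = y`, up to left multiplication by `φ_x(G_x)`. -/
def Hom.fiberSetoid (φ : Hom 𝕏 𝕐) (y : Y.V) :
    Setoid {e : Σ x : X.V, 𝕐.grp (φ.base.onV x) // φ.base.onV e.1 = y} where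
  r e e' := ∃ u : 𝕏.grp e.1.1, e'.1 = ⟨e.1.1, φ.data.loc _ u * e.1.2⟩
  iseqv :=
    { refl := fun e => ⟨1, by simp⟩
      symm := by
        rintro ⟨⟨x, k⟩, h⟩ ⟨⟨x', k'⟩, h'⟩ ⟨u, hu⟩
        cases hu
        exact ⟨u⁻¹, by simp⟩
      trans := by
        rintro ⟨⟨x, k⟩, h⟩ ⟨⟨x', k'⟩, h'⟩ ⟨⟨x'', k''⟩, h''⟩ ⟨u, hu⟩ ⟨v, hv⟩
        cases hu
        cases hv
        exact ⟨v * u, by simp [mul_assoc]⟩ }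

/-- The fibre over the vertex `y`: pairs of a vertex `x` over `y` and a coset of `φ_x(G_x)`. -/
def Hom.Fiber (φ : Hom 𝕏 𝕐) (y : Y.V) : Type u := Quotient (φ.fiberSetoid y)

namespace Hom.Fiber

variable {φ : Hom 𝕏 𝕐}

/-- The point of the fibre over `f(x)` given by the coset of `k`. -/
def pt (φ : Hom 𝕏 𝕐) (x : X.V) (k : 𝕐.grp (φ.base.onV x)) : φ.Fiber (φ.base.onV x) :=
  Quotient.mk _ ⟨⟨x, k⟩, rfl⟩

/-- The vertex y varies in the motive so that it can be replaced by f(x); all transports along f(x)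
= y then vanish. -/
theorem ind {motive : ∀ y, φ.Fiber y → Prop} (h : ∀ x k, motive _ (pt φ x k)) (y : Y.V)
    (e : φ.Fiber y) : motive y e := by
  obtain ⟨⟨⟨x, k⟩, hx⟩⟩ := e
  subst hx
  exact h x k

theorem pt_loc_mul (x : X.V) (u : 𝕏.grp x) (k : 𝕐.grp (φ.base.onV x)) :
    pt φ x (φ.data.loc x u * k) = pt φ x k :=
  (Quotient.sound ⟨u, rfl⟩ : pt φ x k = _).symm

/-- Comparing points in the total space allows f(x) and f(x') to be syntactically different, so no
casts enter. -/
theorem sigma_pt_eq {x x' : X.V} {k : 𝕐.grp (φ.base.onV x)} {k' : 𝕐.grp (φ.base.onV x')}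
    (h : (⟨_, pt φ x k⟩ : Σ y, φ.Fiber y) = ⟨_, pt φ x' k'⟩) :
    ∃ u, (⟨x', k'⟩ : Σ x : X.V, 𝕐.grp (φ.base.onV x)) = ⟨x, φ.data.loc x u * k⟩ := by
  have key : ∀ (y y' : Y.V) (e : φ.Fiber y) (e' : φ.Fiber y')
      (_ : (⟨y, e⟩ : Σ y, φ.Fiber y) = ⟨y', e'⟩) (hx : φ.base.onV x = y)
      (hx' : φ.base.onV x' = y') (_ : e = Quotient.mk _ ⟨⟨x, k⟩, hx⟩)
      (_ : e' = Quotient.mk _ ⟨⟨x', k'⟩, hx'⟩),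
      ∃ u, (⟨x', k'⟩ : Σ x : X.V, 𝕐.grp (φ.base.onV x)) = ⟨x, φ.data.loc x u * k⟩ := by
    intro y y' e e' h hx hx' he he'
    cases h
    exact Quotient.exact (he.symm.trans he')
  exact key _ _ _ _ h rfl rfl rfl rfl

theorem pt_eq {x : X.V} {k k' : 𝕐.grp (φ.base.onV x)} (h : pt φ x k = pt φ x k') :
    ∃ u, k' = φ.data.loc x u * k := by
  obtain ⟨u, hu⟩ := sigma_pt_eq (congrArg (Sigma.mk _) h)
  cases hu
  exact ⟨u, rfl⟩

/-- The vertex of `X` below a point of a fibre. -/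
def vertex {y : Y.V} (e : φ.Fiber y) : X.V :=
  Quotient.lift (fun e => e.1.1) (by rintro e e' ⟨u, hu⟩; exact (congrArg Sigma.fst hu).symm) e

@[simp] theorem vertex_pt (x : X.V) (k : 𝕐.grp (φ.base.onV x)) : (pt φ x k).vertex = x := rfl

/-- The right action of the local group at `y` on the fibre over `y`. -/
def act {y : Y.V} (g : 𝕐.grp y) : φ.Fiber y → φ.Fiber y :=
  Quotient.map (fun e => ⟨⟨e.1.1, e.1.2 * (e.2.symm ▸ g)⟩, e.2⟩) (by
    rintro ⟨⟨x, k⟩, h⟩ ⟨⟨x', k'⟩, h'⟩ ⟨u, hu⟩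
    cases hu
    exact ⟨u, by simp [mul_assoc]⟩)

@[simp] theorem act_pt (x : X.V) (k g : 𝕐.grp (φ.base.onV x)) :
    act g (pt φ x k) = pt φ x (k * g) := rfl

theorem act_act {y : Y.V} (g h : 𝕐.grp y) (e : φ.Fiber y) : act h (act g e) = act (g * h) e := by
  induction y, e using ind with
  | h x k => simp [mul_assoc]

theorem act_one {y : Y.V} (e : φ.Fiber y) : act 1 e = e := by
  induction y, e using ind with
  | h x k => simp

@[simp] theorem vertex_act {y : Y.V} (g : 𝕐.grp y) (e : φ.Fiber y) :
    (act g e).vertex = e.vertex := by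
  induction y, e using ind with
  | h x k => simp

/-! ### The action of edges on fibres -/

/-- The edge of `X` with initial vertex `x` that lies over a given edge. -/
noncomputable def liftOut (φ : Hom 𝕏 𝕐) (x : X.V) : Y.OutEdge (φ.base.onV x) → X.OutEdge x :=
  (Equiv.ofBijective _ (φ.base.bijective_out x)).symm

theorem liftOut_spec (x : X.V) (a : Y.OutEdge (φ.base.onV x)) :
    (⟨φ.base.onV (liftOut φ x a).1, φ.base.onE (liftOut φ x a).2⟩ :
      Y.OutEdge (φ.base.onV x)) = a :=
  (Equiv.ofBijective _ (φ.base.bijective_out x)).apply_symm_apply a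

@[simp] theorem liftOut_onE {x x' : X.V} (b : X.E x x') :
    liftOut φ x ⟨_, φ.base.onE b⟩ = ⟨x', b⟩ :=
  (Equiv.ofBijective _ (φ.base.bijective_out x)).symm_apply_apply ⟨x', b⟩

/-- The action of an edge, from the fibre over its initial vertex to that over its terminal one. -/
noncomputable def edge {y z : Y.V} (a : Y.E y z) : φ.Fiber y → φ.Fiber z :=
  Quotient.map (fun e => ⟨⟨(liftOut φ e.1.1 ⟨z, e.2.symm ▸ a⟩).1,
      φ.data.elt (liftOut φ e.1.1 ⟨z, e.2.symm ▸ a⟩).2 * 𝕐.bd (φ.base.onE (liftOut φ e.1.1 ⟨z, e.2.symm ▸ a⟩).2) e.1.2⟩,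
      congrArg Sigma.fst (liftOut_spec e.1.1 ⟨z, e.2.symm ▸ a⟩)⟩) (by
    rintro ⟨⟨x, k⟩, h⟩ ⟨⟨x', k'⟩, h'⟩ ⟨u, hu⟩
    cases hu
    subst h
    refine ⟨𝕏.bd (liftOut φ x ⟨z, a⟩).2 u, ?_⟩
    dsimp only
    rw [← φ.data.conj_loc, map_mul]
    simp [mul_assoc])

@[simp] theorem edge_pt {x x' : X.V} (b : X.E x x') (k : 𝕐.grp (φ.base.onV x)) :
    edge (φ.base.onE b) (pt φ x k) =
      pt φ x' (φ.data.elt b * 𝕐.bd (φ.base.onE b) k) := by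
  -- The lift equals b only propositionally; generalizing it to c lets the dependent types follow by
  -- substitution.
  have key : ∀ c : X.OutEdge x, c = ⟨x', b⟩ → ∀ h : φ.base.onV c.1 = φ.base.onV x',
      (Quotient.mk _ ⟨⟨c.1, φ.data.elt c.2 * 𝕐.bd (φ.base.onE c.2) k⟩, h⟩ :
        φ.Fiber (φ.base.onV x')) = pt φ x' (φ.data.elt b * 𝕐.bd (φ.base.onE b) k) := by
    rintro _ rfl _
    rfl
  exact key _ (liftOut_onE b) (congrArg Sigma.fst (liftOut_spec (φ := φ) x ⟨_, φ.base.onE b⟩))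

theorem exists_lift {x : X.V} {z : Y.V} (a : Y.E (φ.base.onV x) z) :
    ∃ (x' : X.V) (b : X.E x x'), (⟨_, φ.base.onE b⟩ : Y.OutEdge (φ.base.onV x)) = ⟨z, a⟩ :=
  ⟨_, _, liftOut_spec x ⟨z, a⟩⟩

/-- Reads an equation between fibre points back as an edge of X with an explicit coset
representative. Edges of the isomorphism and lifts of backward edges both come from here. -/
theorem exists_edge_of_edge_eq {x x' : X.V} {k : 𝕐.grp (φ.base.onV x)}
    {k' : 𝕐.grp (φ.base.onV x')} (a : Y.E (φ.base.onV x) (φ.base.onV x'))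
    (h : edge a (pt φ x k) = pt φ x' k') :
    ∃ (b : X.E x x') (v : 𝕏.grp x'), φ.base.onE b = a ∧
      k' = φ.data.loc x' v * (φ.data.elt b * 𝕐.bd (φ.base.onE b) k) := by
  have key : ∀ (z : Y.V) (a : Y.E (φ.base.onV x) z)
      (_ : (⟨z, edge a (pt φ x k)⟩ : Σ y, φ.Fiber y) = ⟨_, pt φ x' k'⟩),
      ∃ (b : X.E x x') (v : 𝕏.grp x'),
        (⟨_, φ.base.onE b⟩ : Y.OutEdge (φ.base.onV x)) = ⟨z, a⟩ ∧
        k' = φ.data.loc x' v * (φ.data.elt b * 𝕐.bd (φ.base.onE b) k) := by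
    intro z a h
    obtain ⟨x'', b, hb⟩ := exists_lift a
    cases hb
    rw [edge_pt] at h
    obtain ⟨v, hv⟩ := sigma_pt_eq h
    cases hv
    exact ⟨b, v, rfl, rfl⟩
  obtain ⟨b, v, hb, hv⟩ := key _ a (congrArg (Sigma.mk _) h)
  exact ⟨b, v, by simpa using hb, hv⟩

theorem act_edge {y z : Y.V} (a : Y.E y z) (g : 𝕐.grp y) (e : φ.Fiber y) :
    act (𝕐.bd a g) (edge a e) = edge a (act g e) := by
  induction y, e using ind with
  | h x k =>
    obtain ⟨x', b, hb⟩ := exists_lift a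
    cases hb
    simp [mul_assoc]

/-- By the twisting law of φ, the representatives of the two sides differ by the left factor
φ(g_{a,b}), which cosets ignore. -/
theorem edge_comp {w y z : Y.V} (a : Y.E y z) (b : Y.E w y) (e : φ.Fiber w) :
    edge a (edge b e) = act (𝕐.tw a b)⁻¹ (edge (Y.comp a b) e) := by
  induction w, e using ind with
  | h x k =>
    obtain ⟨x', b, hb⟩ := exists_lift b
    cases hb
    rw [edge_pt]
    obtain ⟨x'', a, ha⟩ := exists_lift a
    cases ha
    rw [← φ.base.map_comp, edge_pt, edge_pt, act_pt]
    refine Eq.trans (congrArg _ ?_) (pt_loc_mul x'' (𝕏.tw a b) _)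
    have h1 := φ.data.loc_tw a b
    have h2 := 𝕐.conj_bd (φ.base.onE a) (φ.base.onE b) k
    rw [map_mul, ← h2, φ.base.map_comp]
    simp only [← mul_assoc]
    rw [← φ.base.map_comp, h1, φ.base.map_comp]

/-- Translates preimages under an edge into preimages under the coset map, where the covering
condition applies. -/
theorem exists_inEdge_of_edge_eq {y : Y.V} {x : X.V} {k : 𝕐.grp (φ.base.onV x)}
    (a : Y.E y (φ.base.onV x)) (e : φ.Fiber y) (h : edge a e = pt φ x k) :
    ∃ (b : {b : X.InEdge x // φ.base.mapIn b = ⟨y, a⟩}) (v : 𝕏.grp x)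
      (m : 𝕐.grp (φ.base.onV b.1.1)),
      (⟨y, e⟩ : Σ y, φ.Fiber y) = ⟨_, pt φ b.1.1 m⟩ ∧
      k = φ.data.loc x v * (φ.data.elt b.1.2 * 𝕐.bd (φ.base.onE b.1.2) m) ∧
      φ.cosetMap x ⟨y, a⟩ ⟨b, QuotientGroup.mk v⟩ = QuotientGroup.mk k := by
  induction y, e using ind with
  | h x' m =>
    obtain ⟨b, v, rfl, hv⟩ := exists_edge_of_edge_eq a h
    refine ⟨⟨⟨x', b⟩, rfl⟩, v, m, rfl, hv, ?_⟩
    refine QuotientGroup.eq.2 ⟨m, ?_⟩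
    rw [hv]
    group

/-- Injectivity of the coset map identifies the lifted edges and the cosets of v₁, v₂; injectivity
of the boundary map then identifies the source points. Surjectivity of the coset map writes k as
φ(u)φ(b)ψ_a(m), and m gives the preimage. -/
theorem edge_bijective (hφ : φ.IsCovering) {y z : Y.V} (a : Y.E y z) :
    Function.Bijective (edge a : φ.Fiber y → φ.Fiber z) := by
  constructor
  · intro e₁ e₂ h
    generalize he : edge a e₂ = e at h
    induction z, e using ind with
    | h x k =>
      obtain ⟨b₁, v₁, m₁, he₁, hk₁, hc₁⟩ := exists_inEdge_of_edge_eq a e₁ h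
      obtain ⟨b₂, v₂, m₂, he₂, hk₂, hc₂⟩ := exists_inEdge_of_edge_eq a e₂ he
      have hb := (hφ.coset_bijective x ⟨y, a⟩).1 (hc₁.trans hc₂.symm)
      obtain rfl : b₁ = b₂ := congrArg Sigma.fst hb
      obtain ⟨n, hn⟩ := QuotientGroup.eq.1 (eq_of_heq (Sigma.mk.inj hb).2)
      obtain rfl : v₂ = v₁ * 𝕏.bd b₁.1.2 n := by rw [hn]; group
      have hm : m₁ = φ.data.loc _ n * m₂ := by
        apply 𝕐.bd_injective (φ.base.onE b₁.1.2)
        have h2 := hk₁.symm.trans hk₂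
        rw [map_mul, mul_assoc, mul_right_inj, ← φ.data.conj_loc] at h2
        rw [map_mul]
        simpa [mul_assoc] using h2
      rw [hm, pt_loc_mul] at he₁
      exact eq_of_heq (Sigma.mk.inj (he₁.trans he₂.symm)).2
  · intro e
    induction z, e using ind with
    | h x k =>
      obtain ⟨⟨⟨⟨x', b⟩, hb⟩, q⟩, hq⟩ := (hφ.coset_bijective x ⟨y, a⟩).2 (QuotientGroup.mk k)
      cases hb
      obtain ⟨u, rfl⟩ := QuotientGroup.mk_surjective q
      obtain ⟨m, hm⟩ := QuotientGroup.eq.1 hq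
      refine ⟨pt φ x' m, ?_⟩
      change edge (φ.base.onE b) (pt φ x' m) = _
      rw [edge_pt, ← pt_loc_mul x u]
      change 𝕐.bd (φ.base.onE b) m = _ at hm
      rw [hm]
      congr 1
      group

end Hom.Fiber
end ComplexOfGroups

/-! ### The action of paths and its homotopy invariance -/

namespace ComplexOfGroups

variable {X Y : Scwol.{u}} {𝕏 : ComplexOfGroups X} {𝕐 : ComplexOfGroups Y}

namespace Hom.Fiber

variable {φ : Hom 𝕏 𝕐}

/-- The action of an edge as a bijection between fibres. -/
noncomputable def edgeEquiv (hφ : φ.IsCovering) {y z : Y.V} (a : Y.E y z) :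
    φ.Fiber y ≃ φ.Fiber z :=
  Equiv.ofBijective (edge a) (edge_bijective hφ a)

theorem edgeEquiv_apply (hφ : φ.IsCovering) {y z : Y.V} (a : Y.E y z) (e : φ.Fiber y) :
    edgeEquiv hφ a e = edge a e := rfl

/-- The action of paths on the fibres of a covering. -/
noncomputable def pathAct (hφ : φ.IsCovering) :
    ∀ {y z : Y.V}, 𝕐.Path y z → φ.Fiber y → φ.Fiber z
  | _, _, .nil g, e => act g e
  | _, _, .fwd g a p, e => pathAct hφ p (edge a (act g e))
  | _, _, .bwd g a p, e => pathAct hφ p ((edgeEquiv hφ a).symm (act g e))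

variable (hφ : φ.IsCovering)

theorem pathAct_lmul {y z : Y.V} (g : 𝕐.grp y) (p : 𝕐.Path y z) (e : φ.Fiber y) :
    pathAct hφ (p.lmul g) e = pathAct hφ p (act g e) := by
  cases p <;> simp [pathAct, act_act]

theorem pathAct_concat {w y z : Y.V} (p : 𝕐.Path w y) (q : 𝕐.Path y z) (e : φ.Fiber w) :
    pathAct hφ (p.concat q) e = pathAct hφ q (pathAct hφ p e) := by
  induction p with
  | nil g => exact pathAct_lmul hφ g q e
  | fwd g a p ih => exact ih q _
  | bwd g a p ih => exact ih q _

theorem symm_act_bd {y z : Y.V} (a : Y.E y z) (g : 𝕐.grp y) (e : φ.Fiber z) :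
    (edgeEquiv hφ a).symm (act (𝕐.bd a g) e) = act g ((edgeEquiv hφ a).symm e) := by
  rw [Equiv.symm_apply_eq, edgeEquiv_apply, ← act_edge, ← edgeEquiv_apply hφ,
    Equiv.apply_symm_apply]

/-- Slides are `act_edge` and its inverse form; reductions also cancel an edge against its inverse;
shortcuts are `edge_comp`. -/
theorem pathAct_move {y z : Y.V} {p q : 𝕐.Path y z} (h : Path.Move p q) (e : φ.Fiber y) :
    pathAct hφ p e = pathAct hφ q e := by
  cases h with
  | slideFwd a k g h => simp only [pathAct, ← act_act, act_edge]
  | slideBwd a g h k => simp only [pathAct, ← act_act, symm_act_bd]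
  | reduceFwd a g h k =>
    simp only [pathAct, ← act_act, symm_act_bd]
    rw [← edgeEquiv_apply hφ, Equiv.symm_apply_apply]
  | reduceBwd b g k h =>
    simp only [pathAct, ← act_act, ← act_edge]
    rw [← edgeEquiv_apply hφ, Equiv.apply_symm_apply]
  | shortFwd a b g k => simp only [pathAct, ← act_act, act_one, edge_comp]
  | shortBwd a b g k =>
    simp only [pathAct, ← act_act, act_one]
    congr 1
    rw [Equiv.symm_apply_eq, Equiv.symm_apply_eq, edgeEquiv_apply, edgeEquiv_apply, edge_comp,
      ← edgeEquiv_apply hφ (Y.comp a b), Equiv.apply_symm_apply, act_act, act_act]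
    simp

theorem pathAct_homotopic {y z : Y.V} {p q : 𝕐.Path y z} (h : Path.Homotopic p q)
    (e : φ.Fiber y) : pathAct hφ p e = pathAct hφ q e := by
  induction h with
  | rel _ _ h =>
    obtain ⟨p, m, q⟩ := h
    simp only [pathAct_concat, pathAct_move hφ m]
  | refl => rfl
  | symm _ _ _ ih => exact ih.symm
  | trans _ _ _ _ _ ih ih' => exact ih.trans ih'

theorem pathAct_inv_pathAct {y z : Y.V} (p : 𝕐.Path y z) (e : φ.Fiber z) :
    pathAct hφ p (pathAct hφ p.inv e) = e := by
  rw [← pathAct_concat, pathAct_homotopic hφ (Path.inv_concat_self p), pathAct, act_one]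

theorem pathAct_pathAct_inv {y z : Y.V} (p : 𝕐.Path y z) (e : φ.Fiber y) :
    pathAct hφ p.inv (pathAct hφ p e) = e := by
  rw [← pathAct_concat, pathAct_homotopic hφ (Path.concat_inv_self p), pathAct, act_one]

theorem pt_loc (x : X.V) (u : 𝕏.grp x) : pt φ x (φ.data.loc x u) = pt φ x 1 := by
  simpa using pt_loc_mul x u (1 : 𝕐.grp (φ.base.onV x))

/-- Trivial cosets are preserved: φ_x(g) is absorbed on the left, and the factor φ(a)⁻¹ in the image
of an edge cancels the φ(a) produced by its action. -/
theorem pathAct_map {x x' : X.V} (p : 𝕏.Path x x') :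
    pathAct hφ (p.map φ) (pt φ x 1) = pt φ x' 1 := by
  induction p with
  | nil g => simp [Path.map, pathAct, pt_loc]
  | fwd g a p ih => simp [Path.map, Path.concat, pathAct, pathAct_lmul, pt_loc, ih]
  | bwd g a p ih =>
    have h : edgeEquiv hφ (φ.base.onE a) (pt φ _ 1) = pt φ _ (φ.data.elt a) := by
      simp [edgeEquiv_apply]
    simp only [Path.map, Path.concat, pathAct, Path.lmul_bwd, act_pt, one_mul, Path.lmul_one,
      pt_loc_mul]
    rw [← h, Equiv.symm_apply_apply, ih]

/-- The point of the fibre over `τ₀` given by a vertex over `τ₀`. -/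
def basePoint (φ : Hom 𝕏 𝕐) {σ₀ : X.V} {τ₀ : Y.V} (h : φ.base.onV σ₀ = τ₀) : φ.Fiber τ₀ :=
  h ▸ pt φ σ₀ 1

/-- The image of a path of 𝕏 from σ₀ to x reaches the trivial coset at x, and a final group element
k reaches its coset. -/
theorem exists_pathAct_base (hX : X.IsConnected) {σ₀ : X.V} {τ₀ : Y.V}
    (h : φ.base.onV σ₀ = τ₀) {y : Y.V} (e : φ.Fiber y) :
    ∃ q, pathAct hφ q (basePoint φ h) = e := by
  subst h
  have hp : ∀ x, Nonempty (𝕏.Path σ₀ x) := by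
    intro x
    induction hX σ₀ x with
    | refl => exact ⟨.nil 1⟩
    | tail _ h ih =>
      obtain ⟨p⟩ := ih
      rcases h with ⟨⟨a⟩⟩ | ⟨⟨a⟩⟩
      · exact ⟨p.concat (.fwd 1 a (.nil 1))⟩
      · exact ⟨p.concat (.bwd 1 a (.nil 1))⟩
  induction y, e using ind with
  | h x k =>
    obtain ⟨p⟩ := hp x
    exact ⟨(p.map φ).concat (.nil k), by simp [pathAct_concat, basePoint, pathAct_map, pathAct]⟩

/-! ### Path lifting and the stabilizer of the base point -/

/-- The homotopy class of a path ending in `y` together with `y`. -/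
def endClass {w : Y.V} (y : Y.V) (s : 𝕐.Path w y) :
    Σ y, Quotient (Path.setoid 𝕐 w y) := ⟨y, Quotient.mk _ s⟩

theorem endClass_eq {w y : Y.V} {s s' : 𝕐.Path w y} (h : Path.Homotopic s s') :
    endClass y s = endClass y s' :=
  congrArg (Sigma.mk y) (Quotient.sound h)

theorem homotopic_of_endClass_eq {w y : Y.V} {s s' : 𝕐.Path w y}
    (h : endClass y s = endClass y s') : Path.Homotopic s s' :=
  Quotient.exact (eq_of_heq (Sigma.mk.inj h).2)

theorem pathAct_endClass {w y y' : Y.V} {s : 𝕐.Path w y} {s' : 𝕐.Path w y'}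
    (h : endClass y s = endClass y' s') (e : φ.Fiber w) :
    (⟨y, pathAct hφ s e⟩ : Σ y, φ.Fiber y) = ⟨y', pathAct hφ s' e⟩ := by
  obtain ⟨h1, -⟩ := Sigma.mk.inj h
  subst h1
  rw [pathAct_homotopic hφ (homotopic_of_endClass_eq h)]

/-- Up to homotopy the path `s` is the image of a path of `𝕏` followed by a group element. -/
def Lifts (φ : Hom 𝕏 𝕐) (σ₀ : X.V) (y : Y.V) (s : 𝕐.Path (φ.base.onV σ₀) y) : Prop :=
  ∃ (x : X.V) (p : 𝕏.Path σ₀ x) (k : 𝕐.grp (φ.base.onV x)),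
    endClass y s = endClass _ ((p.map φ).concat (.nil k))

variable {σ₀ : X.V}

theorem Lifts.elim {motive : ∀ y, 𝕐.Path (φ.base.onV σ₀) y → Prop}
    (h : ∀ (x : X.V) (p : 𝕏.Path σ₀ x) (k : 𝕐.grp (φ.base.onV x)) (s : 𝕐.Path (φ.base.onV σ₀) _),
      Path.Homotopic s ((p.map φ).concat (.nil k)) → motive _ s)
    {y : Y.V} {s : 𝕐.Path (φ.base.onV σ₀) y} (hs : Lifts φ σ₀ y s) : motive y s := by
  obtain ⟨x, p, k, hp⟩ := hs
  obtain ⟨h1, -⟩ := Sigma.mk.inj hp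
  subst h1
  exact h x p k s (homotopic_of_endClass_eq hp)

theorem Lifts.concat_nil {y : Y.V} {s : 𝕐.Path (φ.base.onV σ₀) y} (hs : Lifts φ σ₀ y s)
    (g : 𝕐.grp y) : Lifts φ σ₀ y (s.concat (.nil g)) := by
  revert g
  refine Lifts.elim (motive := fun y s => ∀ g, Lifts φ σ₀ y (s.concat (.nil g))) ?_ hs
  · intro x p k s hp g
    refine ⟨x, p, k * g, endClass_eq ((hp.concat_right _).trans ?_)⟩
    rw [Path.concat_assoc]
    exact .refl _

theorem Lifts.concat_fwd {y z : Y.V} {s : 𝕐.Path (φ.base.onV σ₀) y} (hs : Lifts φ σ₀ y s)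
    (a : Y.E y z) : Lifts φ σ₀ z (s.concat (.fwd 1 a (.nil 1))) := by
  revert a
  refine Lifts.elim
    (motive := fun y s => ∀ a : Y.E y z, Lifts φ σ₀ z (s.concat (.fwd 1 a (.nil 1)))) ?_ hs
  · intro x p k s hp a
    obtain ⟨x', b, hb⟩ := exists_lift a
    cases hb
    -- Sliding k across the edge gives ψ(k); the factor φ(b) compensates the φ(b)⁻¹ in the image of
    -- b.
    refine ⟨x', p.concat (.fwd 1 b (.nil 1)), φ.data.elt b * 𝕐.bd (φ.base.onE b) k,
      endClass_eq ((hp.concat_right _).trans ?_)⟩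
    rw [Path.concat_assoc, Path.map_concat, Path.concat_assoc]
    refine Path.Homotopic.concat_left _ ?_
    simpa [Path.concat, Path.map] using (Path.Move.slideFwd (φ.base.onE b) 1 k 1).homotopic

theorem Lifts.concat_bwd (hφ : φ.IsCovering) {y z : Y.V} {s : 𝕐.Path (φ.base.onV σ₀) y}
    (hs : Lifts φ σ₀ y s) (a : Y.E z y) : Lifts φ σ₀ z (s.concat (.bwd 1 a (.nil 1))) := by
  revert a
  refine Lifts.elim
    (motive := fun y s => ∀ a : Y.E z y, Lifts φ σ₀ z (s.concat (.bwd 1 a (.nil 1)))) ?_ hs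
  · intro x p k s hp a
    -- A backward edge need not lift from a given vertex; surjectivity of the edge action supplies
    -- the lift, after a correction v in the local group at x.
    obtain ⟨e, he⟩ := (edge_bijective hφ a).2 (pt φ x k)
    induction z, e using ind with
    | h x' m =>
      obtain ⟨b, v, rfl, hk⟩ := exists_edge_of_edge_eq a he
      refine ⟨x', p.concat (.bwd v b (.nil 1)), m, endClass_eq ((hp.concat_right _).trans ?_)⟩
      rw [Path.concat_assoc, Path.map_concat, Path.concat_assoc, hk]
      refine Path.Homotopic.concat_left _ ?_
      simpa [Path.concat, Path.map, mul_assoc] using (Path.Move.slideBwd (φ.base.onE b)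
        (φ.data.loc x v * φ.data.elt b) m 1).homotopic.symm

theorem Lifts.concat (hφ : φ.IsCovering) {y z : Y.V} (q : 𝕐.Path y z)
    {s : 𝕐.Path (φ.base.onV σ₀) y} (hs : Lifts φ σ₀ y s) : Lifts φ σ₀ z (s.concat q) := by
  induction q with
  | nil g => exact hs.concat_nil g
  | fwd g a p ih =>
    simpa [Path.concat_assoc, Path.concat, Path.lmul_one] using
      ih ((hs.concat_nil g).concat_fwd a)
  | bwd g a p ih =>
    simpa [Path.concat_assoc, Path.concat, Path.lmul_one] using
      ih ((hs.concat_nil g).concat_bwd hφ a)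

/-- Path lifting. -/
theorem lifts (hφ : φ.IsCovering) {z : Y.V} (q : 𝕐.Path (φ.base.onV σ₀) z) : Lifts φ σ₀ z q := by
  have h : Lifts φ σ₀ _ (.nil 1) := ⟨σ₀, .nil 1, 1, by simp [Path.map, Path.concat]⟩
  simpa [Path.one_concat] using h.concat hφ q

/-- The stabilizer of the base point is the characteristic subgroup. -/
theorem pathAct_base_eq_iff {τ₀ : Y.V} (h : φ.base.onV σ₀ = τ₀) (q : 𝕐.Path τ₀ τ₀) :
    pathAct hφ q (basePoint φ h) = basePoint φ h ↔
      (Quotient.mk _ q : 𝕐.Pi1 τ₀) ∈ φ.charSubgroup h := by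
  subst h
  constructor
  · intro hq
    obtain ⟨x, p, k, hp⟩ := lifts hφ q
    have h1 := pathAct_endClass hφ hp (pt φ σ₀ 1)
    rw [pathAct_concat, pathAct_map, show pathAct hφ q (pt φ σ₀ 1) = _ from hq] at h1
    simp only [pathAct, act_pt, one_mul] at h1
    -- The lift of q ends at the point of k. As q fixes the base point, the lift closes up at σ₀ and
    -- k is the image of some u, so q is homotopic to the image of a loop.
    obtain ⟨u, hu⟩ := sigma_pt_eq h1
    cases hu
    refine ⟨Quotient.mk _ (p.concat (.nil u)), Quotient.sound ?_⟩
    refine Path.Homotopic.symm ((homotopic_of_endClass_eq hp).trans ?_)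
    rw [Path.map_concat]
    simpa [Path.map] using Path.Homotopic.refl _
  · rintro ⟨⟨p⟩, hp⟩
    have h1 : Path.Homotopic (p.map φ) q := Quotient.exact hp
    exact (pathAct_homotopic hφ h1 _).symm.trans (pathAct_map hφ p)

end Hom.Fiber

/-! ### Coverings with the same characteristic subgroup have isomorphic fibres -/

variable {X₁ X₂ : Scwol.{u}} {𝕏₁ : ComplexOfGroups X₁} {𝕏₂ : ComplexOfGroups X₂}

open Hom.Fiber

/-- A map between the fibres of two morphisms that is compatible with the actions. -/
structure Hom.FiberMap (φ₁ : Hom 𝕏₁ 𝕐) (φ₂ : Hom 𝕏₂ 𝕐) where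
  toFun : ∀ {y : Y.V}, φ₁.Fiber y → φ₂.Fiber y
  map_act : ∀ {y : Y.V} (g : 𝕐.grp y) (e : φ₁.Fiber y), toFun (act g e) = act g (toFun e)
  map_edge : ∀ {y z : Y.V} (a : Y.E y z) (e : φ₁.Fiber y), toFun (edge a e) = edge a (toFun e)

variable {φ₁ : Hom 𝕏₁ 𝕐} {φ₂ : Hom 𝕏₂ 𝕐}

theorem Hom.FiberMap.map_pathAct (Θ : φ₁.FiberMap φ₂) (hφ₁ : φ₁.IsCovering)
    (hφ₂ : φ₂.IsCovering) {y z : Y.V} (q : 𝕐.Path y z) (e : φ₁.Fiber y) :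
    Θ.toFun (pathAct hφ₁ q e) = pathAct hφ₂ q (Θ.toFun e) := by
  induction q with
  | nil g => exact Θ.map_act g e
  | fwd g a p ih => simp only [pathAct, ih, Θ.map_edge, Θ.map_act]
  | bwd g a p ih =>
    simp only [pathAct, ih]
    congr 1
    rw [Equiv.eq_symm_apply, edgeEquiv_apply, ← Θ.map_edge, ← edgeEquiv_apply hφ₁,
      Equiv.apply_symm_apply, Θ.map_act]

/-- Orbit argument: a point reached from the first base point by a path goes to the point reached
from the second base point by the same path. Equal stabilizers make this independent of the path. -/
theorem Hom.FiberMap.exists_map_base (hX₁ : X₁.IsConnected) (hφ₁ : φ₁.IsCovering)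
    (hφ₂ : φ₂.IsCovering) {σ₁ : X₁.V} {σ₂ : X₂.V} {τ : Y.V} (h₁ : φ₁.base.onV σ₁ = τ)
    (h₂ : φ₂.base.onV σ₂ = τ) (hchar : φ₁.charSubgroup h₁ = φ₂.charSubgroup h₂) :
    ∃ Θ : φ₁.FiberMap φ₂, Θ.toFun (basePoint φ₁ h₁) = basePoint φ₂ h₂ := by
  choose q hq using fun (y : Y.V) (e : φ₁.Fiber y) => exists_pathAct_base hφ₁ hX₁ h₁ e
  have key : ∀ {y : Y.V} (p p' : 𝕐.Path τ y),
      pathAct hφ₁ p (basePoint φ₁ h₁) = pathAct hφ₁ p' (basePoint φ₁ h₁) →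
      pathAct hφ₂ p (basePoint φ₂ h₂) = pathAct hφ₂ p' (basePoint φ₂ h₂) := by
    intro y p p' hp
    have h3 : pathAct hφ₁ (p.concat p'.inv) (basePoint φ₁ h₁) = basePoint φ₁ h₁ := by
      rw [pathAct_concat, hp, pathAct_pathAct_inv]
    rw [pathAct_base_eq_iff, hchar, ← pathAct_base_eq_iff hφ₂, pathAct_concat] at h3
    rw [← pathAct_inv_pathAct hφ₂ p' (pathAct hφ₂ p _), h3]
  have hstep : ∀ {y z : Y.V} (p : 𝕐.Path y z) (e : φ₁.Fiber y),
      pathAct hφ₂ (q z (pathAct hφ₁ p e)) (basePoint φ₂ h₂) =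
        pathAct hφ₂ p (pathAct hφ₂ (q y e) (basePoint φ₂ h₂)) := by
    intro y z p e
    rw [← pathAct_concat]
    apply key
    rw [hq, pathAct_concat, hq]
  refine ⟨⟨fun {y} e => pathAct hφ₂ (q y e) (basePoint φ₂ h₂), fun g e => hstep (.nil g) e,
    fun a e => ?_⟩, ?_⟩
  · simpa [pathAct, act_one] using hstep (.fwd 1 a (.nil 1)) e
  · simpa [pathAct, act_one] using key (q τ (basePoint φ₁ h₁)) (.nil 1)
      (by rw [hq, pathAct, act_one])

/-- An equivariant map is determined by its value at the base point, from which every point is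
reachable. -/
theorem Hom.FiberMap.leftInverse (hX₁ : X₁.IsConnected) (hφ₁ : φ₁.IsCovering)
    (hφ₂ : φ₂.IsCovering) {σ₁ : X₁.V} {σ₂ : X₂.V} {τ : Y.V} (h₁ : φ₁.base.onV σ₁ = τ)
    (h₂ : φ₂.base.onV σ₂ = τ) {Θ : φ₁.FiberMap φ₂} {Θ' : φ₂.FiberMap φ₁}
    (h : Θ.toFun (basePoint φ₁ h₁) = basePoint φ₂ h₂) (h' : Θ'.toFun (basePoint φ₂ h₂) = basePoint φ₁ h₁)
    {y : Y.V} (e : φ₁.Fiber y) : Θ'.toFun (Θ.toFun e) = e := by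
  obtain ⟨q, rfl⟩ := exists_pathAct_base hφ₁ hX₁ h₁ e
  rw [Θ.map_pathAct hφ₁ hφ₂, h, Θ'.map_pathAct hφ₂ hφ₁, h']

/-- The map on vertices induced by a map between fibres. -/
def Hom.FiberMap.onV (Θ : φ₁.FiberMap φ₂) (x : X₁.V) : X₂.V := (Θ.toFun (pt φ₁ x 1)).vertex

theorem Hom.FiberMap.vertex_toFun (Θ : φ₁.FiberMap φ₂) {y : Y.V} (e : φ₁.Fiber y) :
    (Θ.toFun e).vertex = Θ.onV e.vertex := by
  induction y, e using ind with
  | h x k =>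
    have h : pt φ₁ x k = act k (pt φ₁ x 1) := by simp
    rw [h, Θ.map_act, vertex_act, vertex_act, vertex_pt, onV]

theorem Hom.FiberMap.onV_leftInverse {Θ : φ₁.FiberMap φ₂} {Θ' : φ₂.FiberMap φ₁}
    (h : ∀ {y : Y.V} (e : φ₁.Fiber y), Θ'.toFun (Θ.toFun e) = e) :
    Function.LeftInverse Θ'.onV Θ.onV := by
  intro x
  rw [onV.eq_def Θ, ← vertex_toFun, h, vertex_pt]

end ComplexOfGroups

/-! ### From an equivariant bijection of fibres to an isomorphism -/

namespace ComplexOfGroups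

variable {Y : Scwol.{u}} {𝕐 : ComplexOfGroups Y}
variable {X₁ X₂ : Scwol.{u}} {𝕏₁ : ComplexOfGroups X₁} {𝕏₂ : ComplexOfGroups X₂}

open Hom.Fiber

/-- A morphism of scwols that is bijective on vertices is an isomorphism. -/
theorem _root_.Scwol.Hom.isIso_of_bijective (f : Scwol.Hom X₁ X₂)
    (hf : Function.Bijective f.onV) : f.IsIso := by
  refine ⟨hf, ?_, ?_⟩
  · rintro ⟨x, x', a⟩ ⟨y, y', b⟩ h
    obtain rfl : x = y := hf.1 (congrArg Sigma.fst h)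
    exact congrArg (Sigma.mk x) ((f.bijective_out x).1 (eq_of_heq (Sigma.mk.inj h).2))
  · rintro ⟨y, y', b⟩
    obtain ⟨x, rfl⟩ := hf.2 y
    obtain ⟨a, ha⟩ := (f.bijective_out x).2 ⟨y', b⟩
    exact ⟨⟨x, a⟩, congrArg (Sigma.mk _) ha⟩

/-- A factorization, up to conjugation by the elements `g x`, of the vertex and edge data of a
morphism through a morphism `φ₂` that is injective on local groups gives an isomorphism. -/
theorem exists_isIso_homotopicRel (φ₂ : Hom 𝕏₂ 𝕐)
    (hφ₂ : ∀ x, Function.Injective (φ₂.data.loc x)) (η : X₁.V → X₂.V)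
    (hη : Function.Bijective η)
    {onE : ∀ {x x' : X₁.V}, X₁.E x x' → Y.E (φ₂.base.onV (η x)) (φ₂.base.onV (η x'))}
    (map_comp : ∀ {x x' x'' : X₁.V} (a : X₁.E x' x'') (b : X₁.E x x'),
      onE (X₁.comp a b) = Y.comp (onE a) (onE b))
    {bij : ∀ x : X₁.V, Function.Bijective (fun a : X₁.OutEdge x =>
      (⟨φ₂.base.onV (η a.1), onE a.2⟩ : Y.OutEdge (φ₂.base.onV (η x))))}
    (data : HomOver ⟨fun x => φ₂.base.onV (η x), onE, map_comp, bij⟩ 𝕏₁ 𝕐)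
    (hinj : ∀ x, Function.Injective (data.loc x))
    (g : ∀ x, 𝕐.grp (φ₂.base.onV (η x)))
    (hloc : ∀ x (u : 𝕏₁.grp x), ∃ v, φ₂.data.loc (η x) v = g x * data.loc x u * (g x)⁻¹)
    (hloc' : ∀ x (v : 𝕏₂.grp (η x)), ∃ u, φ₂.data.loc (η x) v = g x * data.loc x u * (g x)⁻¹)
    (hedge : ∀ {x x' : X₁.V} (a : X₁.E x x'), ∃ (b : X₂.E (η x) (η x')) (v : 𝕏₂.grp (η x')),
      φ₂.base.onE b = onE a ∧ g x' * data.elt a =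
        φ₂.data.loc (η x') v * (φ₂.data.elt b * 𝕐.bd (φ₂.base.onE b) (g x)))
    (σ₁ : X₁.V) (hg : g σ₁ = 1) :
    ∃ ψ : Hom 𝕏₁ 𝕏₂, ψ.IsIso ∧ ψ.base.onV σ₁ = η σ₁ ∧
      Hom.HomotopicRel σ₁ (φ₂.comp ψ) ⟨_, data⟩ := by
  choose loc hloc using hloc
  choose ηE el hE hel using @hedge
  -- After this substitution the two sides of the homotopy lie over definitionally the same morphism
  -- of scwols.
  obtain rfl : @onE = fun {x x'} a => φ₂.base.onE (ηE a) := by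
    funext x x' a
    exact (hE a).symm
  clear hE
  -- Both edges issue from η(x) and have the same image in Y, so they coincide.
  have hcomp : ∀ {x x' x'' : X₁.V} (a : X₁.E x' x'') (b : X₁.E x x'),
      ηE (X₁.comp a b) = X₂.comp (ηE a) (ηE b) := by
    intro x x' x'' a b
    have h := @(φ₂.base.bijective_out (η x)).1 ⟨_, ηE (X₁.comp a b)⟩
      ⟨_, X₂.comp (ηE a) (ηE b)⟩ (congrArg (Sigma.mk _)
        ((map_comp a b).trans (φ₂.base.map_comp _ _).symm))
    exact eq_of_heq (Sigma.mk.inj h).2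
  have hout : ∀ x : X₁.V, Function.Bijective (fun a : X₁.OutEdge x =>
      (⟨η a.1, ηE a.2⟩ : X₂.OutEdge (η x))) := fun x =>
    (Function.Bijective.of_comp_iff' (φ₂.base.bijective_out (η x)) _).1 (bij x)
  -- Every identity in a local group of 𝕏₂ is checked after applying the injective φ₂, where it
  -- becomes a computation with the elements g x.
  let ψ : Hom 𝕏₁ 𝕏₂ :=
    { base := ⟨η, ηE, hcomp, hout⟩
      data :=
        { loc := fun x => MonoidHom.mk' (loc x) fun u v => hφ₂ _ (by simp [hloc])
          elt := el
          conj_loc := fun {x x'} a u => hφ₂ _ (by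
            have h1 := data.conj_loc a u
            have h2 := φ₂.data.conj_loc (ηE a) (loc x u)
            have h3 : φ₂.data.loc (η x') (el a) = g x' * data.elt a *
                (φ₂.data.elt (ηE a) * 𝕐.bd (φ₂.base.onE (ηE a)) (g x))⁻¹ := by
              rw [hel]; group
            simp only [MonoidHom.mk'_apply, map_mul, map_inv, hloc, ← h1, ← h2, h3]
            group)
          loc_tw := fun {x x' x''} a b => hφ₂ _ (by
            have h1 := data.loc_tw a b
            have h2 := φ₂.data.loc_tw (ηE a) (ηE b)
            have h3 := φ₂.data.conj_loc (ηE a) (el b)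
            have h4 := 𝕐.conj_bd (φ₂.base.onE (ηE a)) (φ₂.base.onE (ηE b)) (g x)
            have h5 := congrArg (𝕐.bd (φ₂.base.onE (ηE a))) (hel b)
            have h6 := hel (X₁.comp a b)
            rw [hcomp] at h6
            have h7 : 𝕐.tw (φ₂.base.onE (ηE a)) (φ₂.base.onE (ηE b)) *
                𝕐.bd (Y.comp (φ₂.base.onE (ηE a)) (φ₂.base.onE (ηE b))) (g x) =
                𝕐.bd (φ₂.base.onE (ηE a)) (𝕐.bd (φ₂.base.onE (ηE b)) (g x)) *
                  𝕐.tw (φ₂.base.onE (ηE a)) (φ₂.base.onE (ηE b)) := by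
              rw [← h4]; group
            rw [φ₂.base.map_comp] at h6
            simp only [map_mul] at h5
            -- With this factor appended, the defining equation of `el` for the composite edge
            -- applies.
            refine mul_right_cancel (b := φ₂.data.elt (X₂.comp (ηE a) (ηE b)) *
              𝕐.bd (Y.comp (φ₂.base.onE (ηE a)) (φ₂.base.onE (ηE b))) (g x)) ?_
            simp only [MonoidHom.mk'_apply, map_mul, hloc]
            rw [mul_assoc _ (φ₂.data.loc _ (el _)), ← h6, ← h3]
            calc _ = g x'' * (data.loc x'' (𝕏₁.tw a b) * data.elt (X₁.comp a b)) := by group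
              _ = (g x'' * data.elt a) * 𝕐.bd (φ₂.base.onE (ηE a)) (data.elt b) *
                    𝕐.tw (φ₂.base.onE (ηE a)) (φ₂.base.onE (ηE b)) := by
                  rw [h1]; simp only [mul_assoc]
              _ = φ₂.data.loc _ (el a) * φ₂.data.elt (ηE a) *
                    (𝕐.bd (φ₂.base.onE (ηE a)) (g x') *
                      𝕐.bd (φ₂.base.onE (ηE a)) (data.elt b)) *
                    𝕐.tw (φ₂.base.onE (ηE a)) (φ₂.base.onE (ηE b)) := by
                  rw [hel a]; simp only [mul_assoc]
              _ = φ₂.data.loc _ (el a) * φ₂.data.elt (ηE a) *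
                    𝕐.bd (φ₂.base.onE (ηE a)) (φ₂.data.loc _ (el b)) *
                    𝕐.bd (φ₂.base.onE (ηE a)) (φ₂.data.elt (ηE b)) *
                    (𝕐.tw (φ₂.base.onE (ηE a)) (φ₂.base.onE (ηE b)) *
                    𝕐.bd (Y.comp (φ₂.base.onE (ηE a)) (φ₂.base.onE (ηE b))) (g x)) := by
                  rw [h5, h7]; simp only [mul_assoc]
              _ = φ₂.data.loc _ (el a) * (φ₂.data.elt (ηE a) *
                    𝕐.bd (φ₂.base.onE (ηE a)) (φ₂.data.loc _ (el b)) *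
                    (φ₂.data.elt (ηE a))⁻¹) * (φ₂.data.elt (ηE a) *
                    𝕐.bd (φ₂.base.onE (ηE a)) (φ₂.data.elt (ηE b)) *
                    𝕐.tw (φ₂.base.onE (ηE a)) (φ₂.base.onE (ηE b))) *
                    𝕐.bd (Y.comp (φ₂.base.onE (ηE a)) (φ₂.base.onE (ηE b))) (g x) := by group
              _ = _ := by rw [← h2]; simp only [mul_assoc]) } }
  refine ⟨ψ, ⟨ψ.base.isIso_of_bijective hη, fun x => ⟨fun u v huv => ?_, fun v => ?_⟩⟩, rfl, rfl,
    fun x => (g x)⁻¹, ⟨fun x u => ?_, fun {x x'} a => ?_⟩, by simp [hg]⟩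
  · have h : φ₂.data.loc _ (loc x u) = φ₂.data.loc _ (loc x v) := congrArg _ huv
    rw [hloc, hloc] at h
    exact hinj x (by simpa using h)
  · obtain ⟨u, hu⟩ := hloc' x v
    exact ⟨u, hφ₂ _ ((hloc x u).trans hu.symm)⟩
  · change data.loc x u = (g x)⁻¹ * φ₂.data.loc _ (loc x u) * (g x)⁻¹⁻¹
    rw [hloc]
    group
  · change data.elt a = (g x')⁻¹ * (φ₂.data.loc _ (el a) * φ₂.data.elt (ηE a)) *
      𝕐.bd (φ₂.base.onE (ηE a)) (g x)⁻¹⁻¹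
    rw [inv_inv, mul_assoc, mul_assoc, ← hel]
    group

/-- An equivariant bijection between the fibres of two coverings comes from an isomorphism. -/
theorem exists_isIso_of_fiberMap {φ₁ : Hom 𝕏₁ 𝕐} {φ₂ : Hom 𝕏₂ 𝕐} (hφ₁ : φ₁.IsCovering)
    (hφ₂ : φ₂.IsCovering) (Θ : φ₁.FiberMap φ₂) (hΘ : Function.Bijective Θ.onV)
    (hinj : ∀ y : Y.V, Function.Injective (Θ.toFun (y := y)))
    (σ₁ : X₁.V) (σ₂ : X₂.V)
    (hσ : (⟨_, Θ.toFun (pt φ₁ σ₁ 1)⟩ : Σ y, φ₂.Fiber y) = ⟨_, pt φ₂ σ₂ 1⟩) :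
    ∃ ψ : Hom 𝕏₁ 𝕏₂, ψ.IsIso ∧ ψ.base.onV σ₁ = σ₂ ∧
      Hom.HomotopicRel σ₁ (φ₂.comp ψ) φ₁ := by
  have hex : ∀ x : X₁.V, ∃ (z : X₂.V) (k : 𝕐.grp (φ₂.base.onV z)),
      (⟨_, Θ.toFun (pt φ₁ x 1)⟩ : Σ y, φ₂.Fiber y) = ⟨_, pt φ₂ z k⟩ ∧
        (x = σ₁ → (⟨z, k⟩ : Σ z, 𝕐.grp (φ₂.base.onV z)) = ⟨σ₂, 1⟩) := by
    intro x
    -- At σ₁ the representative must be 1 at σ₂, since the homotopy is relative to σ₁; elsewhere any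
    -- representative serves.
    by_cases hx : x = σ₁
    · subst hx
      exact ⟨σ₂, 1, hσ, fun _ => rfl⟩
    · have h : ∀ (y : Y.V) (e : φ₂.Fiber y), ∃ (z : X₂.V) (k : 𝕐.grp (φ₂.base.onV z)),
          (⟨_, e⟩ : Σ y, φ₂.Fiber y) = ⟨_, pt φ₂ z k⟩ :=
        ind fun z k => ⟨z, k, rfl⟩
      obtain ⟨z, k, hk⟩ := h _ (Θ.toFun (pt φ₁ x 1))
      exact ⟨z, k, hk, fun h => absurd h hx⟩
  choose η g hg hσ' using hex
  have hη : η = Θ.onV := by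
    funext x
    have h : ∀ (s : Σ y, φ₂.Fiber y), s = ⟨_, pt φ₂ (η x) (g x)⟩ → η x = s.2.vertex := by
      rintro _ rfl
      rfl
    exact h _ (hg x)
  rw [← hη] at hΘ
  clear hη
  have hpt : ∀ x (u : 𝕏₁.grp x), pt φ₁ x (φ₁.data.loc x u) = pt φ₁ x 1 := pt_loc
  have hedge : ∀ {x x' : X₁.V} (a : X₁.E x x'), Θ.toFun (pt φ₁ x' (φ₁.data.elt a)) =
      edge (φ₁.base.onE a) (Θ.toFun (pt φ₁ x 1)) := by
    intro x x' a
    rw [← Θ.map_edge, edge_pt, map_one, mul_one]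
  -- With φ₁ taken apart, its vertex map can be replaced by that of φ₂ composed with η, so g x and
  -- the data of φ₁ live in the same groups.
  obtain ⟨⟨onV, onE, mc, bo⟩, data⟩ := φ₁
  obtain rfl : onV = fun x => φ₂.base.onV (η x) := by
    funext x
    exact congrArg Sigma.fst (hg x)
  have hg' : ∀ x, Θ.toFun (pt _ x 1) = pt φ₂ (η x) (g x) := fun x =>
    eq_of_heq (Sigma.mk.inj (hg x)).2
  have hgk : ∀ x k, Θ.toFun (pt _ x k) = pt φ₂ (η x) (g x * k) := by
    intro x k
    rw [← act_pt, ← hg', ← Θ.map_act, act_pt, one_mul]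
  have hσ₁ := hσ' σ₁ rfl
  obtain rfl : η σ₁ = σ₂ := congrArg Sigma.fst hσ₁
  refine exists_isIso_homotopicRel φ₂ hφ₂.loc_injective η hΘ mc data hφ₁.loc_injective g
    (fun x u => ?_) (fun x v => ?_) (fun {x x'} a => ?_) σ₁ (eq_of_heq (Sigma.mk.inj hσ₁).2)
  -- φ₁(u) represents the trivial coset, so g x and g x · φ₁(u) represent the same coset of the
  -- image of φ₂.
  · have h := (hg' x).symm.trans ((congrArg Θ.toFun (hpt x u)).symm.trans (hgk x (data.loc x u)))
    obtain ⟨v, hv⟩ := pt_eq h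
    exact ⟨v, by rw [hv]; group⟩
  -- Conversely, Θ sends the coset of this conjugate to that of φ₂(v) · g x, which is the image of
  -- the trivial coset; injectivity of Θ puts the conjugate in the image of φ₁.
  · have h := hgk x ((g x)⁻¹ * φ₂.data.loc _ v * g x)
    rw [mul_assoc, mul_inv_cancel_left, pt_loc_mul, ← hg'] at h
    obtain ⟨u, hu⟩ := pt_eq (hinj _ h).symm
    refine ⟨u, ?_⟩
    rw [mul_one] at hu
    change φ₂.data.loc (η x) v = g x * data.loc x u * (g x)⁻¹
    rw [show data.loc x u = _ from hu.symm]
    group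
  · have h : edge (onE a) (pt φ₂ (η x) (g x)) = pt φ₂ (η x') (g x' * data.elt a) :=
      ((hgk x' _).symm.trans ((hedge a).trans (congrArg _ (hg' x)))).symm
    exact exists_edge_of_edge_eq (onE a) h

end ComplexOfGroups

/-! ### The lemma on coverings with equal characteristic subgroups -/

theorem mainTheorem8 {X₁ X₂ Y : Scwol.{u}}
    (hX₁ : X₁.IsConnected) (hX₂ : X₂.IsConnected) (hY : Y.IsConnected)
    (𝕏₁ : ComplexOfGroups X₁) (𝕏₂ : ComplexOfGroups X₂) (𝕐 : ComplexOfGroups Y)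
    (h𝕏₁ : 𝕏₁.IsDevelopable) (h𝕏₂ : 𝕏₂.IsDevelopable) (h𝕐 : 𝕐.IsDevelopable)
    (σ₁ : X₁.V) (σ₂ : X₂.V) (τ : Y.V)
    (φ₁ : ComplexOfGroups.Hom 𝕏₁ 𝕐) (φ₂ : ComplexOfGroups.Hom 𝕏₂ 𝕐)
    (hφ₁ : φ₁.IsCovering) (hφ₂ : φ₂.IsCovering)
    (h₁ : φ₁.base.onV σ₁ = τ) (h₂ : φ₂.base.onV σ₂ = τ)
    (hchar : φ₁.charSubgroup h₁ = φ₂.charSubgroup h₂) :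
    ∃ η : ComplexOfGroups.Hom 𝕏₁ 𝕏₂, η.IsIso ∧ η.base.onV σ₁ = σ₂ ∧
      ComplexOfGroups.Hom.HomotopicRel σ₁ (φ₂.comp η) φ₁ := by
  obtain ⟨Θ, hΘ⟩ := ComplexOfGroups.Hom.FiberMap.exists_map_base hX₁ hφ₁ hφ₂ h₁ h₂ hchar
  obtain ⟨Θ', hΘ'⟩ :=
    ComplexOfGroups.Hom.FiberMap.exists_map_base hX₂ hφ₂ hφ₁ h₂ h₁ hchar.symm
  have hl {y : Y.V} (e : φ₁.Fiber y) : Θ'.toFun (Θ.toFun e) = e :=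
    ComplexOfGroups.Hom.FiberMap.leftInverse hX₁ hφ₁ hφ₂ h₁ h₂ hΘ hΘ' e
  have hr {y : Y.V} (e : φ₂.Fiber y) : Θ.toFun (Θ'.toFun e) = e :=
    ComplexOfGroups.Hom.FiberMap.leftInverse hX₂ hφ₂ hφ₁ h₂ h₁ hΘ' hΘ e
  refine ComplexOfGroups.exists_isIso_of_fiberMap hφ₁ hφ₂ Θ
    ⟨(ComplexOfGroups.Hom.FiberMap.onV_leftInverse hl).injective,
      (ComplexOfGroups.Hom.FiberMap.onV_leftInverse hr).surjective⟩
    (fun y => Function.LeftInverse.injective (hl (y := y))) σ₁ σ₂ ?_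
  have h {X : Scwol.{u}} {𝕏 : ComplexOfGroups X} (φ : ComplexOfGroups.Hom 𝕏 𝕐) {σ : X.V}
      {y : Y.V} (hy : φ.base.onV σ = y) :
      (⟨y, ComplexOfGroups.Hom.Fiber.basePoint φ hy⟩ : Σ y, φ.Fiber y) =
        ⟨_, ComplexOfGroups.Hom.Fiber.pt φ σ 1⟩ := by
    subst hy
    rfl
  subst h₁
  exact (congrArg (Sigma.mk (β := φ₂.Fiber) (φ₁.base.onV σ₁)) hΘ).trans (h φ₂ h₂)
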